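/- **Proposition 2.8 (parametrization of non-planar minimal surfaces).** Let $\Sigma\subset\mathbb R^2\cong\mathbb C$ be a simply-connected domain and let $X:\Sigma\to\mathbb R^3$ be a smooth conformally immersed minimal surface all of whose curvature lines are planar curves (a curvature line being a regular smooth curve whose velocity is everywhere a principal direction), and suppose that $X(\Sigma)$ is not contained in a plane. Then there is a $\theta\in\left(-\frac{\pi}{4},\frac{3\pi}{4}\right)$ such that, up to isometries and homotheties of $\mathbb R^3$ and a conformal change of the parameters, $X$ is a piece of the surface $$ X^{\theta}(u,v)= \begin{cases} \left(\dfrac{u\cos\theta\,\sqrt{\cos2\theta}-\sin\theta\,\sinh(u\sqrt{\cos2\theta})\cos(v\sqrt{\cos2\theta})}{(\cos2\theta)^{3/2}},\ \dfrac{v\sin\theta\,\sqrt{\cos2\theta}-\cos\theta\,\cosh(u\sqrt{\cos2\theta})\sin(v\sqrt{\cos2\theta})}{(\cos2\theta)^{3/2}},\ \dfrac{\cosh(u\sqrt{\cos2\theta})\cos(v\sqrt{\cos2\theta})-1}{\cos2\theta}\right), & \theta\neq\frac{\pi}{4},\\[14pt] \left(-\dfrac{u(-6+u^2-3v^2)}{6\sqrt2},\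 \dfrac{v(-6-3u^2+v^2)}{6\sqrt2},\ \dfrac{u^2-v^2}{2}\right), & \theta=\frac{\pi}{4}, \end{cases} $$ where the roots are principal complex roots (all components are real). That is, there are $r>0$, an isometry $g$ of $\mathbb R^3$ and a holomorphic $\varphi:\Sigma\to\mathbb C$ with nowhere vanishing derivative such that $X=r\,g\circ X^\theta\circ\varphi$ on $\Sigma$. Moreover, for every $\theta\in\left(-\frac{\pi}{4},\frac{3\pi}{4}\right)$ the surface $X^\theta$ is obtained from the Weierstrass data $$ h^\theta(z)=\begin{cases}\dfrac{\sqrt{\cos2\theta}}{\cos\theta-\sin\theta}\tanh\!\left(\dfrac{\sqrt{\cos2\theta}}{2}z\right),&\theta\ne\frac\pi4,\\[8pt]\dfrac{z}{\sqrt2},&\theta=\frac\pi4,\end{cases} \qquad \eta^\theta(z)=\begin{cases}\dfrac{1}{\cos\theta+\sin\theta}\cosh^2\!\left(\dfrac{\sqrt{\cos2\theta}}{2}z\right),&\theta\ne\frac\pi4,\\[8pt]\dfrac{1}{\sqrt2},&\theta=\frac\pi4,\end{cases} $$ with $z=u+iv$: the function $h^\theta$ is meromorphic on $\mathbb C$,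 $\eta^\theta$ is entire, the forms $(1-(h^\theta)^2)\eta^\theta\,dz$, $i(1+(h^\theta)^2)\eta^\theta\,dz$ and $2h^\theta\eta^\theta\,dz$ extend holomorphically to $\mathbb C$, and $$X^\theta(u,v)=\mathrm{Re}\int_0^{u+iv}\left(1-(h^\theta)^2,\ i(1+(h^\theta)^2),\ 2h^\theta\right)\eta^\theta\,dz .$$ -/

import Mathlib

open scoped ContDiff

noncomputable section

namespace PlanarCurv

/-- Euclidean three-space. -/
abbrev E3 : Type := EuclideanSpace ℝ (Fin 3)

/-! ### Surfaces `X : Σ → ℝ³` on a planar domain; the point `(u, v)` is `z = u + i v ∈ ℂ` -/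

/-- The partial derivative `Y_u`. -/
def partialU (Y : ℂ → E3) (z : ℂ) : E3 := fderiv ℝ Y z 1

/-- The partial derivative `Y_v`. -/
def partialV (Y : ℂ → E3) (z : ℂ) : E3 := fderiv ℝ Y z Complex.I

/-- The vector product `X_u × X_v`. -/
def normalField (X : ℂ → E3) (z : ℂ) : E3 :=
  WithLp.toLp 2 (crossProduct (WithLp.ofLp (partialU X z)) (WithLp.ofLp (partialV X z)))

/-- The unit normal vector field `N = X_u × X_v / ‖X_u × X_v‖`. -/
def unitNormal (X : ℂ → E3) (z : ℂ) : E3 := ‖normalField X z‖⁻¹ • normalField X z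

/-- `X` is a smooth conformal immersion on `S`: its first fundamental form is
`e^{2ω}(du² + dv²)` there, where `e^{2ω} = ‖X_u‖² > 0`. -/
structure IsConformalImmersion (X : ℂ → E3) (S : Set ℂ) : Prop where
  contDiffOn : ContDiffOn ℝ ∞ X S
  partialU_ne_zero : ∀ z ∈ S, partialU X z ≠ 0
  norm_eq : ∀ z ∈ S, ‖partialU X z‖ = ‖partialV X z‖
  inner_eq_zero : ∀ z ∈ S, inner ℝ (partialU X z) (partialV X z) = 0

/-- The mean curvature `H = ⟨X_uu + X_vv, N⟩ / (2 e^{2ω})` of a conformal immersion with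
`e^{2ω} = ‖X_u‖²`. -/
def meanCurvature (X : ℂ → E3) (z : ℂ) : ℝ :=
  inner ℝ (partialU (partialU X) z + partialV (partialV X) z) (unitNormal X z) /
    (2 * ‖partialU X z‖ ^ 2)

/-- `X` is a (conformally immersed) minimal surface on `S`. -/
structure IsMinimalSurface (X : ℂ → E3) (S : Set ℂ) : Prop where
  conformal : IsConformalImmersion X S
  meanCurvature_eq_zero : ∀ z ∈ S, meanCurvature X z = 0

/-- A set of points of `ℝ³` lies in some affine plane. -/
def LiesInPlane (A : Set E3) : Prop :=
  ∃ (n : E3) (c : ℝ), n ≠ 0 ∧ ∀ p ∈ A, inner ℝ n p = c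

/-- `γ : I → S` is a curvature line of `X`: a regular smooth curve whose velocity is everywhere a
principal direction, that is, `dN(γ') = -k dX(γ')` for some real `k` (depending on the
parameter). -/
structure IsCurvatureLine (X : ℂ → E3) (S : Set ℂ) (γ : ℝ → ℂ) (I : Set ℝ) : Prop where
  mapsTo : Set.MapsTo γ I S
  contDiffOn : ContDiffOn ℝ ∞ γ I
  regular : ∀ t ∈ I, deriv γ t ≠ 0
  principal : ∀ t ∈ I, ∃ k : ℝ,
    fderiv ℝ (unitNormal X) (γ t) (deriv γ t) = -k • fderiv ℝ X (γ t) (deriv γ t)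

/-- Every curvature line of `X` on `S` (parametrized by an open interval) is a planar curve. -/
def HasPlanarCurvatureLines (X : ℂ → E3) (S : Set ℂ) : Prop :=
  ∀ (γ : ℝ → ℂ) (I : Set ℝ), IsOpen I → I.OrdConnected → IsCurvatureLine X S γ I →
    LiesInPlane ((fun t => X (γ t)) '' I)

/-! ### The explicit family -/

/-- `√(cos 2θ)`, the principal complex square root (`cos 2θ` may be negative). -/
def sqrtCos (θ : ℝ) : ℂ := (Real.cos (2 * θ) : ℂ) ^ (1 / 2 : ℂ)

/-- The three components of `X^θ(u, v)`, evaluated in `ℂ`. For `θ ∈ (-π/4, 3π/4)` they are real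
numbers; complex arithmetic is only needed because `√(cos 2θ)` is imaginary when
`cos 2θ < 0`. -/
def surfaceC (θ u v : ℝ) : Fin 3 → ℂ :=
  if θ = Real.pi / 4 then
    ![-(u * (-6 + u ^ 2 - 3 * v ^ 2) / (6 * (Real.sqrt 2 : ℂ))),
      v * (-6 - 3 * u ^ 2 + v ^ 2) / (6 * (Real.sqrt 2 : ℂ)),
      (u ^ 2 - v ^ 2) / 2]
  else
    ![(u * Real.cos θ * sqrtCos θ
        - Real.sin θ * Complex.sinh (u * sqrtCos θ) * Complex.cos (v * sqrtCos θ)) /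
        (Real.cos (2 * θ) : ℂ) ^ (3 / 2 : ℂ),
      (v * Real.sin θ * sqrtCos θ
        - Real.cos θ * Complex.cosh (u * sqrtCos θ) * Complex.sin (v * sqrtCos θ)) /
        (Real.cos (2 * θ) : ℂ) ^ (3 / 2 : ℂ),
      (Complex.cosh (u * sqrtCos θ) * Complex.cos (v * sqrtCos θ) - 1) /
        (Real.cos (2 * θ) : ℂ)]

/-- The surface `X^θ : ℝ² → ℝ³`. -/
def surface (θ : ℝ) (z : ℂ) : E3 := WithLp.toLp 2 fun j => (surfaceC θ z.re z.im j).re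

/-- The function `h^θ` of the Weierstrass data (at its poles, Lean gives it the value `0`). -/
def dataH (θ : ℝ) (z : ℂ) : ℂ :=
  if θ = Real.pi / 4 then z / (Real.sqrt 2 : ℂ)
  else sqrtCos θ / (Real.cos θ - Real.sin θ) * Complex.tanh (sqrtCos θ / 2 * z)

/-- The function `η^θ` of the Weierstrass data. -/
def dataEta (θ : ℝ) (z : ℂ) : ℂ :=
  if θ = Real.pi / 4 then 1 / (Real.sqrt 2 : ℂ)
  else 1 / (Real.cos θ + Real.sin θ) * Complex.cosh (sqrtCos θ / 2 * z) ^ 2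

/-- The integrand `((1 - h²) η, i (1 + h²) η, 2 h η)` of the Weierstrass representation. -/
def weierstrassForm (h η : ℂ → ℂ) (z : ℂ) : Fin 3 → ℂ :=
  ![(1 - h z ^ 2) * η z, Complex.I * (1 + h z ^ 2) * η z, 2 * h z * η z]

/-- `Y(z) = Re ∫₀^z (1 - h², i (1 + h²), 2 h) η dz` on `ℂ`, with `h` meromorphic, `η` entire, and
the integrand entire after removal of its singularities at the poles of `h`: there is an entire
`F : ℂ → ℂ³` with `F(0) = 0` and `Re F = Y` whose derivative is the integrand wherever `h` is
holomorphic (so everywhere outside a closed discrete set). -/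
def HasWeierstrassData (Y : ℂ → E3) (h η : ℂ → ℂ) : Prop :=
  Meromorphic h ∧ Differentiable ℂ η ∧
    ∃ F : ℂ → Fin 3 → ℂ, Differentiable ℂ F ∧ F 0 = 0 ∧
      (∀ z, AnalyticAt ℂ h z → HasDerivAt F (weierstrassForm h η z) z) ∧
      ∀ z j, Y z j = (F z j).re

/-- The restriction of `X` to `S` is, up to isometries and homotheties of `ℝ³`, a piece of the
surface `Y : ℂ → ℝ³`: after a conformal change of the parameter, `X` is the composition of `Y`
with an isometry and a homothety. -/
def IsPieceOf (X : ℂ → E3) (S : Set ℂ) (Y : ℂ → E3) : Prop :=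
  ∃ (r : ℝ) (g : E3 ≃ᵢ E3) (φ : ℂ → ℂ), 0 < r ∧ DifferentiableOn ℂ φ S ∧
    (∀ z ∈ S, deriv φ z ≠ 0) ∧ ∀ z ∈ S, X z = r • g (Y (φ z))

end PlanarCurv

end

open scoped ContDiff

noncomputable section

namespace PlanarCurv

open Complex Matrix Topology Set

/-! ### Vector algebra in dimension three -/

/-! The null form `P = X_u - i X_v` of a minimal surface is holomorphic and isotropic, and its Hopf
coefficient `Q = N · P'` satisfies `P × P' = -i Q P` and `P' · P' = Q²`, so `Q` is holomorphic too.
Away from umbilics choose `σ² = Q` and differentiate along the field `1 / σ`: put `W₀ = P / σ`, `W₁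
= W₀' / σ`, `W₂ = W₁' / σ`. All products of these vectors are then the constants `0, 1, -1`, except
`s = W₂ · W₂`.

The integral curves of `1 / σ` are curvature lines. If such a curve lies in a plane with normal `n`,
then `n · W₀` is imaginary along it, and differentiating along the curve makes `n · W₁` and `n · W₂`
imaginary as well. Expanding the real vector `n` in the frame and computing `n · n > 0` forces `s`
to be real (`im_dot_self_eq_zero_of_real_orthogonal`). Being holomorphic, `s` is constant. Replacing
`σ` by `i σ` changes the sign of `s`, so `s = -κ²` may be assumed.

Now `W₂' = κ² σ W₁`, and in the parameter `ζ = ∫ σ` the frame solves a linear system with constant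
coefficients: `W₀` is a quadratic polynomial in `ζ` (`eq_polynomial`) or a combination of `1,
e^{κζ}, e^{-κζ}` (`eq_exponential`). Hence `W₀` stays bounded where `ζ` does. At an isolated zero of
`Q` this would force `P = σ W₀` to vanish, so a non-planar surface has no umbilics (`hopf_ne_zero`)
and the frame exists on the whole domain.

What remains is algebra over `ℂ`: a real rotation and a translation of `ζ` bring the coefficient
vectors to those of `curveDeriv θ` (`exists_normalForm_exponential`,
`exists_normalForm_polynomial`), and integration gives the surface (`isPieceOf_of_nullForm_eq`). The
Weierstrass data come from the explicit holomorphic curve with real part `X^θ`, by the double-angle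
formulas and `cos 2θ = (cos θ - sin θ)(cos θ + sin θ)`. -/

theorem smul_cross_of_isotropic (P Q D : Fin 3 → ℂ) (hP : P ⬝ᵥ P = 0) (hD : P ⬝ᵥ D = 0) :
    (Q ⬝ᵥ P) • (crossProduct P D) = (Q ⬝ᵥ crossProduct P D) • P := by
  -- The orthogonal complement of an isotropic `P` contains `P` itself, so `P × D` is parallel to
  -- `P`; `Q` is a test vector that reads off the factor without division.
  simp only [dotProduct, Fin.sum_univ_three] at *
  ext j
  fin_cases j <;> simp [cross_apply]
  · linear_combination -(Q 1 * P 2 - Q 2 * P 1) * hD + (Q 1 * D 2 - Q 2 * D 1) * hP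
  · linear_combination -(Q 2 * P 0 - Q 0 * P 2) * hD + (Q 2 * D 0 - Q 0 * D 2) * hP
  · linear_combination -(Q 0 * P 1 - Q 1 * P 0) * hD + (Q 0 * D 1 - Q 1 * D 0) * hP

/-- Computing `D × (P × D)` in two ways gives `(D · D) P = -c² P`; pairing with `Q` cancels `P`. -/
theorem dot_self_of_cross_eq_smul (P Q D : Fin 3 → ℂ) (c : ℂ) (hP : Q ⬝ᵥ P ≠ 0)
    (hD : P ⬝ᵥ D = 0) (hc : crossProduct P D = c • P) : D ⬝ᵥ D = -c ^ 2 := by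
  have h0 := congrFun hc 0
  have h1 := congrFun hc 1
  have h2 := congrFun hc 2
  simp [cross_apply] at h0 h1 h2
  simp only [dotProduct, Fin.sum_univ_three] at *
  apply mul_left_cancel₀ hP
  linear_combination (Q 0 * D 0 + Q 1 * D 1 + Q 2 * D 2) * hD
    + (Q 1 * D 2 - Q 2 * D 1 - c * Q 0) * h0 + (Q 2 * D 0 - Q 0 * D 2 - c * Q 1) * h1
    + (Q 0 * D 1 - Q 1 * D 0 - c * Q 2) * h2

theorem eq_zero_of_orthogonal_cross (p q y : Fin 3 → ℝ) (hn : crossProduct p q ≠ 0)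
    (hp : y ⬝ᵥ p = 0) (hq : y ⬝ᵥ q = 0) (hy : y ⬝ᵥ crossProduct p q = 0) : y = 0 := by
  have key : (y ⬝ᵥ y) * (crossProduct p q ⬝ᵥ crossProduct p q) = 0 := by
    simp only [dotProduct, Fin.sum_univ_three, cross_apply] at *
    simp only [Matrix.cons_val_zero, Matrix.cons_val_one, Matrix.cons_val] at *
    linear_combination ((p 0 ^ 2 + p 1 ^ 2 + p 2 ^ 2) * (y 0 * q 0 + y 1 * q 1 + y 2 * q 2)
      - 2 * (p 0 * q 0 + p 1 * q 1 + p 2 * q 2) * (y 0 * p 0 + y 1 * p 1 + y 2 * p 2)) * hq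
      + (q 0 ^ 2 + q 1 ^ 2 + q 2 ^ 2) * (y 0 * p 0 + y 1 * p 1 + y 2 * p 2) * hp
      + (y 0 * (p 1 * q 2 - p 2 * q 1) + y 1 * (p 2 * q 0 - p 0 * q 2)
        + y 2 * (p 0 * q 1 - p 1 * q 0)) * hy
  rcases mul_eq_zero.1 key with h | h
  · exact dotProduct_self_eq_zero.1 h
  · exact absurd (dotProduct_self_eq_zero.1 h) hn

theorem inner_eq_dotProduct (x y : E3) : inner ℝ x y = x.ofLp ⬝ᵥ y.ofLp := by
  simp [PiLp.inner_apply, dotProduct, mul_comm]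

/-! ### The holomorphic null form of a minimal surface -/

/-- The form `X_u - i X_v`. -/
def nullForm (X : ℂ → E3) (z : ℂ) : Fin 3 → ℂ :=
  fun j => (partialU X z j : ℂ) - I * (partialV X z j : ℂ)

theorem fderiv_apply_eq_re_nullForm (X : ℂ → E3) (z w : ℂ) (j : Fin 3) :
    fderiv ℝ X z w j = (nullForm X z j * w).re := by
  have hw : w = w.re • (1 : ℂ) + w.im • I := by simp
  conv_lhs => rw [hw]
  rw [map_add, map_smul, map_smul]
  simp [nullForm, partialU, partialV]
  ring

/-- The scalar `e^{2ω}`. -/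
def metricFactor (X : ℂ → E3) (z : ℂ) : ℝ := ‖partialU X z‖ ^ 2

/-- The coefficient of the Hopf differential. -/
def hopf (X : ℂ → E3) (z : ℂ) : ℂ :=
  (fun j => (unitNormal X z j : ℂ)) ⬝ᵥ deriv (nullForm X) z

section

variable {X : ℂ → E3} {S : Set ℂ}

theorem IsConformalImmersion.metricFactor_pos (h : IsConformalImmersion X S) {z : ℂ} (hz : z ∈ S) :
    0 < metricFactor X z := by
  have := h.partialU_ne_zero z hz
  unfold metricFactor
  positivity

theorem IsConformalImmersion.dot_uu (_h : IsConformalImmersion X S) (z : ℂ) :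
    (partialU X z).ofLp ⬝ᵥ (partialU X z).ofLp = metricFactor X z := by
  rw [← inner_eq_dotProduct, real_inner_self_eq_norm_sq, metricFactor]

theorem IsConformalImmersion.dot_vv (h : IsConformalImmersion X S) {z : ℂ} (hz : z ∈ S) :
    (partialV X z).ofLp ⬝ᵥ (partialV X z).ofLp = metricFactor X z := by
  rw [← inner_eq_dotProduct, real_inner_self_eq_norm_sq, metricFactor, h.norm_eq z hz]

theorem IsConformalImmersion.dot_uv (h : IsConformalImmersion X S) {z : ℂ} (hz : z ∈ S) :
    (partialU X z).ofLp ⬝ᵥ (partialV X z).ofLp = 0 := by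
  rw [← inner_eq_dotProduct, h.inner_eq_zero z hz]

theorem IsConformalImmersion.norm_normalField (h : IsConformalImmersion X S) {z : ℂ}
    (hz : z ∈ S) : ‖normalField X z‖ = metricFactor X z := by
  have h1 : ‖normalField X z‖ ^ 2 = metricFactor X z ^ 2 := by
    rw [← real_inner_self_eq_norm_sq, inner_eq_dotProduct, normalField, cross_dot_cross,
      h.dot_uu, h.dot_vv hz, dotProduct_comm (partialV X z).ofLp, h.dot_uv hz]
    ring
  exact (pow_left_inj₀ (norm_nonneg _) (h.metricFactor_pos hz).le two_ne_zero).1 h1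

theorem IsConformalImmersion.normalField_eq (h : IsConformalImmersion X S) {z : ℂ}
    (hz : z ∈ S) : normalField X z = metricFactor X z • unitNormal X z := by
  rw [unitNormal, h.norm_normalField hz, smul_smul,
    mul_inv_cancel₀ (h.metricFactor_pos hz).ne', one_smul]

theorem IsConformalImmersion.norm_unitNormal (h : IsConformalImmersion X S) {z : ℂ}
    (hz : z ∈ S) : ‖unitNormal X z‖ = 1 := by
  have := (h.metricFactor_pos hz).ne'
  rw [unitNormal, norm_smul, h.norm_normalField hz, norm_inv, Real.norm_of_nonneg
    (h.metricFactor_pos hz).le, inv_mul_cancel₀ this]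

theorem inner_unitNormal_u (X : ℂ → E3) (z : ℂ) : inner ℝ (unitNormal X z) (partialU X z) = 0 := by
  rw [unitNormal, inner_smul_left, inner_eq_dotProduct, normalField, dotProduct_comm,
    dot_self_cross, mul_zero]

theorem inner_unitNormal_v (X : ℂ → E3) (z : ℂ) : inner ℝ (unitNormal X z) (partialV X z) = 0 := by
  rw [unitNormal, inner_smul_left, inner_eq_dotProduct, normalField, dotProduct_comm,
    dot_cross_self, mul_zero]

/-- A vector orthogonal to the frame `X_u, X_v, N` vanishes. -/
theorem IsConformalImmersion.eq_zero_of_inner (h : IsConformalImmersion X S) {z : ℂ}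
    (hz : z ∈ S) {y : E3} (hu : inner ℝ y (partialU X z) = 0)
    (hv : inner ℝ y (partialV X z) = 0) (hn : inner ℝ y (unitNormal X z) = 0) : y = 0 := by
  have hne : normalField X z ≠ 0 := by
    rw [← norm_ne_zero_iff, h.norm_normalField hz]
    exact (h.metricFactor_pos hz).ne'
  have hy : inner ℝ y (normalField X z) = 0 := by
    rw [h.normalField_eq hz, inner_smul_right, hn, mul_zero]
  rw [inner_eq_dotProduct] at hu hv hy
  have := eq_zero_of_orthogonal_cross _ _ y.ofLp (fun h0 => hne ?_) hu hv hy
  · exact (WithLp.ofLp_eq_zero 2).1 this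
  · rw [normalField, h0]; rfl

theorem IsConformalImmersion.contDiffAt (h : IsConformalImmersion X S) (hS : IsOpen S) {z : ℂ}
    (hz : z ∈ S) : ContDiffAt ℝ ∞ X z :=
  h.contDiffOn.contDiffAt (hS.mem_nhds hz)

theorem IsConformalImmersion.hasFDerivAt_fderiv (h : IsConformalImmersion X S) (hS : IsOpen S)
    {z : ℂ} (hz : z ∈ S) (w : ℂ) :
    HasFDerivAt (fun z => fderiv ℝ X z w) ((fderiv ℝ (fderiv ℝ X) z).flip w) z := by
  have h1 : ContDiffAt ℝ ∞ (fderiv ℝ X) z := (h.contDiffAt hS hz).fderiv_right (by simp)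
  exact (h1.differentiableAt (by simp)).hasFDerivAt.clm_apply (hasFDerivAt_const w z)
    |>.congr_fderiv (by ext; simp)

theorem IsConformalImmersion.second_symm (h : IsConformalImmersion X S) (hS : IsOpen S)
    {z : ℂ} (hz : z ∈ S) (v w : ℂ) :
    fderiv ℝ (fderiv ℝ X) z v w = fderiv ℝ (fderiv ℝ X) z w v :=
  ((h.contDiffAt hS hz).isSymmSndFDerivAt (by simpa using (WithTop.coe_le_coe.2 le_top : ((2 : ℕ∞) : WithTop ℕ∞) ≤ ∞))).eq v w

end

section

variable {X : ℂ → E3} {S : Set ℂ}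

theorem IsConformalImmersion.inner_second_sub (h : IsConformalImmersion X S) (hS : IsOpen S)
    {z : ℂ} (hz : z ∈ S) (w : ℂ) :
    inner ℝ (fderiv ℝ (fderiv ℝ X) z w 1) (partialU X z) =
      inner ℝ (fderiv ℝ (fderiv ℝ X) z w I) (partialV X z) := by
  have hu := h.hasFDerivAt_fderiv hS hz 1
  have hv := h.hasFDerivAt_fderiv hS hz I
  have h1 := (hu.inner ℝ hu).sub (hv.inner ℝ hv)
  have h2 : (fun z => inner ℝ (fderiv ℝ X z 1) (fderiv ℝ X z 1)
      - inner ℝ (fderiv ℝ X z I) (fderiv ℝ X z I)) =ᶠ[𝓝 z] fun _ => 0 := by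
    filter_upwards [hS.mem_nhds hz] with y hy
    have := h.norm_eq y hy
    simp only [partialU, partialV] at this
    simp [this]
  have h3 := congrArg (fun L => L w) (h1.unique ((hasFDerivAt_const _ _).congr_of_eventuallyEq h2))
  simp [real_inner_comm] at h3
  simp only [partialU, partialV]
  rw [real_inner_comm, real_inner_comm (fderiv ℝ X z I)]
  linarith

theorem IsConformalImmersion.inner_second_add (h : IsConformalImmersion X S) (hS : IsOpen S)
    {z : ℂ} (hz : z ∈ S) (w : ℂ) :
    inner ℝ (fderiv ℝ (fderiv ℝ X) z w 1) (partialV X z) +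
      inner ℝ (fderiv ℝ (fderiv ℝ X) z w I) (partialU X z) = 0 := by
  have hu := h.hasFDerivAt_fderiv hS hz 1
  have hv := h.hasFDerivAt_fderiv hS hz I
  have h1 := hu.inner ℝ hv
  have h2 : (fun z => inner ℝ (fderiv ℝ X z 1) (fderiv ℝ X z I)) =ᶠ[𝓝 z] fun _ => 0 := by
    filter_upwards [hS.mem_nhds hz] with y hy
    exact h.inner_eq_zero y hy
  have h3 := congrArg (fun L => L w) (h1.unique ((hasFDerivAt_const _ _).congr_of_eventuallyEq h2))
  simp at h3
  simp only [partialU, partialV]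
  rw [real_inner_comm (fderiv ℝ X z 1) (fderiv ℝ (fderiv ℝ X) z w I)]
  linarith

/-- Differentiating the conformality relations kills the tangential components of `X_uu + X_vv`, and
`H = 0` kills the normal one. -/
theorem IsMinimalSurface.laplacian_eq_zero (h : IsMinimalSurface X S) (hS : IsOpen S)
    {z : ℂ} (hz : z ∈ S) :
    fderiv ℝ (fderiv ℝ X) z 1 1 + fderiv ℝ (fderiv ℝ X) z I I = 0 := by
  have hc := h.conformal
  have e1 := hc.inner_second_sub hS hz 1
  have e2 := hc.inner_second_sub hS hz I
  have e3 := hc.inner_second_add hS hz 1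
  have e4 := hc.inner_second_add hS hz I
  rw [hc.second_symm hS hz I 1] at e2 e4
  refine hc.eq_zero_of_inner hz ?_ ?_ ?_
  · rw [inner_add_left]; linarith
  · rw [inner_add_left]; linarith
  · have := h.meanCurvature_eq_zero z hz
    have hE := hc.metricFactor_pos hz
    rw [metricFactor] at hE
    rw [meanCurvature, div_eq_zero_iff, or_iff_left (by positivity)] at this
    have hu : partialU (partialU X) z = fderiv ℝ (fderiv ℝ X) z 1 1 := by
      rw [partialU, show partialU X = fun z => fderiv ℝ X z 1 from rfl,
        (hc.hasFDerivAt_fderiv hS hz 1).fderiv]; rfl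
    have hv : partialV (partialV X) z = fderiv ℝ (fderiv ℝ X) z I I := by
      rw [partialV, show partialV X = fun z => fderiv ℝ X z I from rfl,
        (hc.hasFDerivAt_fderiv hS hz I).fderiv]; rfl
    rwa [hu, hv] at this

theorem IsMinimalSurface.hasDerivAt_nullForm (h : IsMinimalSurface X S) (hS : IsOpen S)
    {z : ℂ} (hz : z ∈ S) :
    HasDerivAt (nullForm X) (fun j => (fderiv ℝ (fderiv ℝ X) z 1 1 j : ℂ)
      - I * (fderiv ℝ (fderiv ℝ X) z 1 I j : ℂ)) z := by
  have hc := h.conformal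
  rw [hasDerivAt_pi]
  intro j
  have hu := ((EuclideanSpace.proj (𝕜 := ℝ) j).hasFDerivAt).comp z (hc.hasFDerivAt_fderiv hS hz 1)
  have hv := ((EuclideanSpace.proj (𝕜 := ℝ) j).hasFDerivAt).comp z (hc.hasFDerivAt_fderiv hS hz I)
  have hu' := ofRealCLM.hasFDerivAt.comp z hu
  have hv' := (ofRealCLM.hasFDerivAt.comp z hv).const_mul I
  -- Complex linearity of the real derivative amounts to the Cauchy-Riemann equations, which here
  -- are harmonicity and symmetry of the second derivative.
  refine hasFDerivAt_of_restrictScalars ℝ (hu'.sub hv') ?_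
  have hL := congrArg (fun y : E3 => (y j : ℂ)) (h.laplacian_eq_zero hS hz)
  simp at hL
  have hs := congrArg (fun y : E3 => (y j : ℂ)) (hc.second_symm hS hz 1 I)
  beta_reduce at hs
  ext w
  have hw : w = w.re • (1 : ℂ) + w.im • I := by simp
  rw [hw, map_add, map_smul, map_smul, map_add, map_smul, map_smul]
  simp
  left
  linear_combination I * hL + hs - (fderiv ℝ (fderiv ℝ X) z 1 I j : ℂ) * I_sq

theorem IsMinimalSurface.fderiv_nullForm (h : IsMinimalSurface X S) (hS : IsOpen S)
    {z : ℂ} (hz : z ∈ S) (w : ℂ) (j : Fin 3) :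
    (fderiv ℝ (fderiv ℝ X) z w 1 j : ℂ) - I * (fderiv ℝ (fderiv ℝ X) z w I j : ℂ) =
      deriv (nullForm X) z j * w := by
  rw [(h.hasDerivAt_nullForm hS hz).deriv]
  have hL := congrArg (fun y : E3 => (y j : ℂ)) (h.laplacian_eq_zero hS hz)
  simp at hL
  have hs := congrArg (fun y : E3 => (y j : ℂ)) (h.conformal.second_symm hS hz 1 I)
  beta_reduce at hs
  have hw : w = w.re • (1 : ℂ) + w.im • I := by simp
  conv_lhs => rw [hw]
  rw [map_add, map_smul, map_smul]
  simp
  linear_combination (-w.im : ℂ) * I * hL - (w.im : ℂ) * hs + (w.im : ℂ) *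
    (fderiv ℝ (fderiv ℝ X) z 1 I j : ℂ) * I_sq + ((fderiv ℝ (fderiv ℝ X) z 1 1 j : ℂ)
    - I * (fderiv ℝ (fderiv ℝ X) z 1 I j : ℂ)) * re_add_im w

theorem IsMinimalSurface.differentiableOn_nullForm (h : IsMinimalSurface X S) (hS : IsOpen S) :
    DifferentiableOn ℂ (nullForm X) S := fun _ hz =>
  (h.hasDerivAt_nullForm hS hz).differentiableAt.differentiableWithinAt

theorem IsConformalImmersion.nullForm_dot_self (h : IsConformalImmersion X S) {z : ℂ}
    (hz : z ∈ S) : nullForm X z ⬝ᵥ nullForm X z = 0 := by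
  have h1 := congrArg ofReal (h.dot_uu z)
  have h2 := congrArg ofReal (h.dot_vv hz)
  have h3 := congrArg ofReal (h.dot_uv hz)
  simp only [dotProduct, Fin.sum_univ_three, nullForm] at *
  push_cast at *
  linear_combination h1 - h2 - 2 * I * h3 + ((partialV X z).ofLp 0 * (partialV X z).ofLp 0 +
    (partialV X z).ofLp 1 * (partialV X z).ofLp 1 +
    (partialV X z).ofLp 2 * (partialV X z).ofLp 2) * I_sq

theorem IsConformalImmersion.conj_nullForm_dot (h : IsConformalImmersion X S) {z : ℂ}
    (hz : z ∈ S) : star (nullForm X z) ⬝ᵥ nullForm X z = 2 * metricFactor X z := by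
  have h1 := congrArg ofReal (h.dot_uu z)
  have h2 := congrArg ofReal (h.dot_vv hz)
  simp only [dotProduct, Fin.sum_univ_three, nullForm, Pi.star_apply, star_def, map_sub, map_mul,
    conj_ofReal, conj_I] at *
  push_cast at *
  linear_combination h1 + h2 - ((partialV X z).ofLp 0 * (partialV X z).ofLp 0 +
    (partialV X z).ofLp 1 * (partialV X z).ofLp 1 +
    (partialV X z).ofLp 2 * (partialV X z).ofLp 2) * I_sq

theorem IsConformalImmersion.nullForm_ne_zero (h : IsConformalImmersion X S) {z : ℂ}
    (hz : z ∈ S) : nullForm X z ≠ 0 := by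
  intro h0
  have := h.conj_nullForm_dot hz
  rw [h0, dotProduct_zero] at this
  have h1 := (h.metricFactor_pos hz).ne'
  simp [h1] at this

/-- The derivative of a constant bilinear square vanishes. -/
theorem dot_deriv_eq_zero {W W' : ℂ → Fin 3 → ℂ} {z : ℂ} {c : ℂ} (hW : HasDerivAt W (W' z) z)
    (hc : ∀ᶠ y in 𝓝 z, W y ⬝ᵥ W y = c) : W z ⬝ᵥ W' z = 0 := by
  have hj := hasDerivAt_pi.1 hW
  have h1 : HasDerivAt (fun y => W y 0 * W y 0 + W y 1 * W y 1 + W y 2 * W y 2) _ z :=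
    (((hj 0).mul (hj 0)).add ((hj 1).mul (hj 1))).add ((hj 2).mul (hj 2))
  have h2 : (fun y => W y 0 * W y 0 + W y 1 * W y 1 + W y 2 * W y 2) =ᶠ[𝓝 z] fun _ => c := by
    filter_upwards [hc] with y hy
    simpa [dotProduct, Fin.sum_univ_three] using hy
  have h3 := h1.unique ((hasDerivAt_const z c).congr_of_eventuallyEq h2)
  simp only [dotProduct, Fin.sum_univ_three]
  linear_combination h3 / 2

theorem IsMinimalSurface.nullForm_dot_deriv (h : IsMinimalSurface X S) (hS : IsOpen S)
    {z : ℂ} (hz : z ∈ S) : nullForm X z ⬝ᵥ deriv (nullForm X) z = 0 := by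
  refine dot_deriv_eq_zero (W' := deriv (nullForm X)) (c := 0)
    (h.hasDerivAt_nullForm hS hz).differentiableAt.hasDerivAt ?_
  filter_upwards [hS.mem_nhds hz] with y hy
  exact h.conformal.nullForm_dot_self hy

/-- The triple product equals `(conj P × P) · P'`, and `conj P × P = -2i X_u × X_v = -2i e^{2ω} N`.
-/
theorem IsConformalImmersion.conj_nullForm_dot_cross (h : IsConformalImmersion X S)
    {z : ℂ} (hz : z ∈ S) : star (nullForm X z) ⬝ᵥ crossProduct (nullForm X z)
      (deriv (nullForm X) z) = -2 * I * metricFactor X z * hopf X z := by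
  have hN : ∀ j, ((normalField X z j : ℝ) : ℂ) = metricFactor X z * unitNormal X z j := by
    intro j
    rw [h.normalField_eq hz]
    simp
  have h0 := hN 0
  have h1 := hN 1
  have h2 := hN 2
  simp only [normalField, cross_apply, cons_val_zero, cons_val_one, cons_val] at h0 h1 h2
  simp only [dotProduct, Fin.sum_univ_three, hopf, cross_apply, Pi.star_apply, cons_val_zero,
    cons_val_one, cons_val]
  generalize deriv (nullForm X) z = D
  simp only [nullForm, star_def, map_sub, map_mul, conj_ofReal, conj_I]
  push_cast at *
  linear_combination -2 * I * D 0 * h0 - 2 * I * D 1 * h1 - 2 * I * D 2 * h2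

theorem IsMinimalSurface.nullForm_cross_deriv (h : IsMinimalSurface X S) (hS : IsOpen S)
    {z : ℂ} (hz : z ∈ S) :
    crossProduct (nullForm X z) (deriv (nullForm X) z) = (-I * hopf X z) • nullForm X z := by
  have h1 := smul_cross_of_isotropic (nullForm X z) (star (nullForm X z)) (deriv (nullForm X) z)
    (h.conformal.nullForm_dot_self hz) (h.nullForm_dot_deriv hS hz)
  rw [h.conformal.conj_nullForm_dot hz, h.conformal.conj_nullForm_dot_cross hz] at h1
  have hE : (2 * metricFactor X z : ℂ) ≠ 0 := by
    simpa using (h.conformal.metricFactor_pos hz).ne'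
  apply smul_right_injective _ hE
  simp only [h1, smul_smul]
  congr 1
  ring

theorem IsMinimalSurface.deriv_dot_deriv (h : IsMinimalSurface X S) (hS : IsOpen S)
    {z : ℂ} (hz : z ∈ S) :
    deriv (nullForm X) z ⬝ᵥ deriv (nullForm X) z = hopf X z ^ 2 := by
  rw [dot_self_of_cross_eq_smul (nullForm X z) (star (nullForm X z)) _ (-I * hopf X z) ?_
    (h.nullForm_dot_deriv hS hz) (h.nullForm_cross_deriv hS hz)]
  · linear_combination -hopf X z ^ 2 * I_sq
  · rw [h.conformal.conj_nullForm_dot hz]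
    simpa using (h.conformal.metricFactor_pos hz).ne'

/-- The normal `N` is not holomorphic, but `P × P' = -i Q P` exhibits `Q` locally as a quotient of
holomorphic functions, by any component of `P` that does not vanish. -/
theorem IsMinimalSurface.differentiableOn_hopf (h : IsMinimalSurface X S) (hS : IsOpen S) :
    DifferentiableOn ℂ (hopf X) S := by
  intro z hz
  obtain ⟨j, hj⟩ := Function.ne_iff.1 (h.conformal.nullForm_ne_zero hz)
  have hP := h.differentiableOn_nullForm hS
  have hD : DifferentiableOn ℂ (deriv (nullForm X)) S := hP.deriv hS
  have hPa := hP.differentiableAt (hS.mem_nhds hz)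
  have hDa := hD.differentiableAt (hS.mem_nhds hz)
  rw [differentiableAt_pi] at hPa hDa
  have hcross : DifferentiableAt ℂ (fun y => crossProduct (nullForm X y)
      (deriv (nullForm X) y) j) z := by
    fin_cases j <;> simp only [cross_apply] <;> simp <;> fun_prop (disch := assumption)
  have hev : ∀ᶠ y in 𝓝 z, nullForm X y j ≠ 0 := (hPa j).continuousAt.eventually_ne hj
  have : hopf X =ᶠ[𝓝 z] fun y => I * crossProduct (nullForm X y) (deriv (nullForm X) y) j /
      nullForm X y j := by
    filter_upwards [hS.mem_nhds hz, hev] with y hy hne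
    rw [h.nullForm_cross_deriv hS hy]
    simp only [Pi.smul_apply, smul_eq_mul]
    field_simp
    linear_combination hopf X y * I_sq
  exact ((hcross.const_mul I).div (hPa j) hj |>.congr_of_eventuallyEq this).differentiableWithinAt

/-! ### The Weingarten equation and the planar case -/

theorem IsConformalImmersion.differentiableAt_unitNormal (h : IsConformalImmersion X S)
    (hS : IsOpen S) {z : ℂ} (hz : z ∈ S) : DifferentiableAt ℝ (unitNormal X) z := by
  have hu : DifferentiableAt ℝ (partialU X) z := (h.hasFDerivAt_fderiv hS hz 1).differentiableAt
  have hv : DifferentiableAt ℝ (partialV X) z := (h.hasFDerivAt_fderiv hS hz I).differentiableAt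
  have hn : DifferentiableAt ℝ (normalField X) z := by
    rw [differentiableAt_euclidean] at hu hv ⊢
    intro j
    simp only [normalField, cross_apply]
    fin_cases j <;> simp <;> fun_prop (disch := assumption)
  have hne : normalField X z ≠ 0 := by
    rw [← norm_ne_zero_iff, h.norm_normalField hz]
    exact (h.metricFactor_pos hz).ne'
  exact ((hn.norm ℝ hne).inv (norm_ne_zero_iff.2 hne)).smul hn

theorem IsMinimalSurface.inner_unitNormal_second (h : IsMinimalSurface X S) (hS : IsOpen S)
    {z : ℂ} (hz : z ∈ S) (w : ℂ) :
    inner ℝ (unitNormal X z) (fderiv ℝ (fderiv ℝ X) z w 1) = (hopf X z * w).re ∧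
      inner ℝ (unitNormal X z) (fderiv ℝ (fderiv ℝ X) z w I) = -(hopf X z * w).im := by
  have h0 := h.fderiv_nullForm hS hz w 0
  have h1 := h.fderiv_nullForm hS hz w 1
  have h2 := h.fderiv_nullForm hS hz w 2
  have key : hopf X z * w = ((inner ℝ (unitNormal X z) (fderiv ℝ (fderiv ℝ X) z w 1) : ℝ) : ℂ) -
      I * ((inner ℝ (unitNormal X z) (fderiv ℝ (fderiv ℝ X) z w I) : ℝ) : ℂ) := by
    rw [inner_eq_dotProduct, inner_eq_dotProduct]
    simp only [hopf, dotProduct, Fin.sum_univ_three]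
    push_cast
    linear_combination -(unitNormal X z 0 : ℂ) * h0 - (unitNormal X z 1 : ℂ) * h1
      - (unitNormal X z 2 : ℂ) * h2
  rw [key]
  simp

/-- The Weingarten equation in the direction `w`. -/
theorem IsMinimalSurface.fderiv_unitNormal (h : IsMinimalSurface X S) (hS : IsOpen S)
    {z : ℂ} (hz : z ∈ S) (w : ℂ) (k : ℝ)
    -- Multiplied by `w`, this says that `Q w²` is the real number `k |w|² e^{2ω}`, the usual
    -- condition for a principal direction.
    (hk : hopf X z * w = k * (starRingEnd ℂ w) * metricFactor X z) :
    fderiv ℝ (unitNormal X) z w = -k • fderiv ℝ X z w := by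
  have hc := h.conformal
  have hN := (hc.differentiableAt_unitNormal hS hz).hasFDerivAt
  have hu := hc.hasFDerivAt_fderiv hS hz 1
  have hv := hc.hasFDerivAt_fderiv hS hz I
  have hNu := congrArg (fun L => L w) ((hN.inner ℝ hu).unique
    ((hasFDerivAt_const (0 : ℝ) z).congr_of_eventuallyEq
      (Filter.Eventually.of_forall (inner_unitNormal_u X))))
  have hNv := congrArg (fun L => L w) ((hN.inner ℝ hv).unique
    ((hasFDerivAt_const (0 : ℝ) z).congr_of_eventuallyEq
      (Filter.Eventually.of_forall (inner_unitNormal_v X))))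
  have hNN := congrArg (fun L => L w) ((hN.inner ℝ hN).unique
    ((hasFDerivAt_const (1 : ℝ) z).congr_of_eventuallyEq (by
      filter_upwards [hS.mem_nhds hz] with y hy
      rw [real_inner_self_eq_norm_sq, hc.norm_unitNormal hy, one_pow])))
  simp only [ContinuousLinearMap.comp_apply, ContinuousLinearMap.prod_apply,
    fderivInnerCLM_apply, ContinuousLinearMap.flip_apply, _root_.zero_apply]
    at hNu hNv hNN
  obtain ⟨h1, h2⟩ := h.inner_unitNormal_second hS hz w
  rw [h1] at hNu
  rw [h2] at hNv
  rw [hk] at hNu hNv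
  have hw : w = w.re • (1 : ℂ) + w.im • I := by simp
  have hX : fderiv ℝ X z w = w.re • partialU X z + w.im • partialV X z := by
    conv_lhs => rw [hw]
    rw [map_add, map_smul, map_smul]; rfl
  have huu : inner ℝ (partialU X z) (partialU X z) = metricFactor X z := by
    rw [inner_eq_dotProduct, hc.dot_uu]
  have hvv : inner ℝ (partialV X z) (partialV X z) = metricFactor X z := by
    rw [inner_eq_dotProduct, hc.dot_vv hz]
  have huv : inner ℝ (partialU X z) (partialV X z) = 0 := hc.inner_eq_zero z hz
  have hvu : inner ℝ (partialV X z) (partialU X z) = 0 := by rw [real_inner_comm, huv]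
  have hNu0 := inner_unitNormal_u X z
  have hNv0 := inner_unitNormal_v X z
  rw [real_inner_comm] at hNu0 hNv0
  change _ + inner ℝ _ (partialU X z) = 0 at hNu
  change _ + inner ℝ _ (partialV X z) = 0 at hNv
  have hNN' := real_inner_comm (unitNormal X z) (fderiv ℝ (unitNormal X) z w)
  rw [neg_smul, eq_neg_iff_add_eq_zero]
  simp only [mul_re, mul_im, ofReal_re, ofReal_im, conj_re, conj_im] at hNu hNv
  refine hc.eq_zero_of_inner hz ?_ ?_ ?_
  · simp only [hX, inner_add_left, inner_smul_left, huu, hvu]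
    simp
    linarith
  · simp only [hX, inner_add_left, inner_smul_left, hvv, huv]
    simp
    linarith
  · simp only [hX, inner_add_left, inner_smul_left, hNu0, hNv0]
    simp
    linarith

/-- A connected minimal surface whose Hopf differential vanishes is planar. -/
theorem IsMinimalSurface.liesInPlane_of_hopf_eq_zero (h : IsMinimalSurface X S) (hS : IsOpen S)
    (hS' : IsPreconnected S) (hQ : ∀ z ∈ S, hopf X z = 0) : LiesInPlane (X '' S) := by
  rcases S.eq_empty_or_nonempty with rfl | ⟨z₀, hz₀⟩
  · exact ⟨EuclideanSpace.single 0 1, 0, by simp, by simp⟩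
  have hc := h.conformal
  have hN : ∀ z ∈ S, fderiv ℝ (unitNormal X) z = 0 := by
    -- With `Q = 0` every direction is principal with `k = 0`, so the normal is constant.
    intro z hz
    ext1 w
    simpa using h.fderiv_unitNormal hS hz w 0 (by simp [hQ z hz])
  have hNc : ∀ z ∈ S, unitNormal X z = unitNormal X z₀ := fun z hz =>
    hS.is_const_of_fderiv_eq_zero hS'
      (fun y hy => (hc.differentiableAt_unitNormal hS hy).differentiableWithinAt) hN hz hz₀
  have hXd : ∀ z ∈ S, HasFDerivAt X (fderiv ℝ X z) z := fun z hz =>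
    ((hc.contDiffAt hS hz).differentiableAt (by simp)).hasFDerivAt
  have hI : ∀ z ∈ S, HasFDerivAt (fun y => inner ℝ (unitNormal X z₀) (X y))
      (0 : ℂ →L[ℝ] ℝ) z := by
    intro z hz
    refine ((hasFDerivAt_const _ z).inner ℝ (hXd z hz)).congr_fderiv ?_
    ext1 w
    have hw : w = w.re • (1 : ℂ) + w.im • I := by simp
    have hX : fderiv ℝ X z w = w.re • partialU X z + w.im • partialV X z := by
      conv_lhs => rw [hw]
      rw [map_add, map_smul, map_smul]; rfl
    simp only [ContinuousLinearMap.comp_apply, ContinuousLinearMap.prod_apply,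
      fderivInnerCLM_apply, _root_.zero_apply, hX, inner_add_right, inner_smul_right,
      ← hNc z hz, inner_unitNormal_u, inner_unitNormal_v]
    simp
  refine ⟨unitNormal X z₀, inner ℝ (unitNormal X z₀) (X z₀), ?_, ?_⟩
  · rw [← norm_ne_zero_iff, hc.norm_unitNormal hz₀]; exact one_ne_zero
  · rintro _ ⟨z, hz, rfl⟩
    exact hS.is_const_of_fderiv_eq_zero hS'
      (fun y hy => (hI y hy).differentiableAt.differentiableWithinAt)
      (fun y hy => (hI y hy).fderiv) hz hz₀

end

/-! ### Holomorphic square roots and logarithms -/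

/-- Near `z`, continuity makes `f` the composition of `e ∘ f` with a local inverse of `e`. This
upgrades continuous square roots and logarithms to holomorphic ones. -/
theorem differentiableAt_of_comp {e f : ℂ → ℂ} {e' z : ℂ} (hf : ContinuousAt f z)
    (he : HasStrictDerivAt e e' (f z)) (he' : e' ≠ 0)
    (hef : DifferentiableAt ℂ (fun y => e (f y)) z) : DifferentiableAt ℂ f z := by
  have h1 : ∀ᶠ x in 𝓝 (f z), he.localInverse e e' (f z) he' (e x) = x :=
    he.hasStrictFDerivAt_equiv he' |>.eventually_left_inverse
  have h2 : DifferentiableAt ℂ (he.localInverse e e' (f z) he') (e (f z)) :=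
    (he.to_localInverse he').hasDerivAt.differentiableAt
  have h3 : f =ᶠ[𝓝 z] fun y => he.localInverse e e' (f z) he' (e (f y)) := by
    filter_upwards [hf.eventually h1] with y hy using hy.symm
  exact (h2.comp z hef).congr_of_eventuallyEq h3

theorem exists_differentiableOn_sq_eq {U : Set ℂ} (hU : IsOpen U) (hUc : IsSimplyConnected U)
    {Q : ℂ → ℂ} (hQ : DifferentiableOn ℂ Q U) (h0 : ∀ z ∈ U, Q z ≠ 0) :
    ∃ σ : ℂ → ℂ, DifferentiableOn ℂ σ U ∧ (∀ z ∈ U, σ z ≠ 0) ∧ ∀ z ∈ U, σ z ^ 2 = Q z := by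
  obtain ⟨σ, hσ, hsq⟩ := exists_continuousOn_pow_eq hUc hU hQ.continuousOn
    (by rintro ⟨z, hz, hz'⟩; exact h0 z hz hz') two_ne_zero
  have hne : ∀ z ∈ U, σ z ≠ 0 := by
    intro z hz h
    apply h0 z hz
    rw [← hsq, h]; simp
  refine ⟨σ, fun z hz => ?_, hne, fun z _ => hsq z⟩
  refine (differentiableAt_of_comp (e := fun w => w ^ 2) (hσ.continuousAt (hU.mem_nhds hz))
    (hasStrictDerivAt_pow 2 (σ z)) (by simpa using hne z hz) ?_).differentiableWithinAt
  simpa only [hsq] using hQ.differentiableAt (hU.mem_nhds hz)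

theorem exists_differentiableOn_exp_eq {U : Set ℂ} (hU : IsOpen U) (hUc : IsSimplyConnected U)
    {Q : ℂ → ℂ} (hQ : DifferentiableOn ℂ Q U) (h0 : ∀ z ∈ U, Q z ≠ 0) :
    ∃ L : ℂ → ℂ, DifferentiableOn ℂ L U ∧ ∀ z ∈ U, exp (L z) = Q z := by
  obtain ⟨L, hL, he⟩ := exists_continuousOn_eqOn_exp_comp hUc hU hQ.continuousOn
    (by rintro ⟨z, hz, hz'⟩; exact h0 z hz hz')
  refine ⟨L, fun z hz => ?_, he⟩
  refine (differentiableAt_of_comp (hL.continuousAt (hU.mem_nhds hz))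
    (hasStrictDerivAt_exp (L z)) (exp_ne_zero _) ?_).differentiableWithinAt
  refine (hQ.differentiableAt (hU.mem_nhds hz)).congr_of_eventuallyEq ?_
  filter_upwards [hU.mem_nhds hz] with y hy using he hy

/-- Integral curves of the holomorphic vector field `1 / σ`. -/
theorem exists_integralCurve {U : Set ℂ} (hU : IsOpen U) {σ : ℂ → ℂ}
    (hσ : DifferentiableOn ℂ σ U) (h0 : ∀ z ∈ U, σ z ≠ 0) {z : ℂ} (hz : z ∈ U) :
    ∃ (γ : ℝ → ℂ) (ε : ℝ), 0 < ε ∧ γ 0 = z ∧ ContDiffOn ℝ ∞ γ (Ioo (-ε) ε) ∧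
      ∀ t ∈ Ioo (-ε) ε, γ t ∈ U ∧ HasDerivAt γ (σ (γ t))⁻¹ t := by
  obtain ⟨r, hr, hrU⟩ := Metric.isOpen_iff.1 hU z hz
  obtain ⟨ζ, hζ⟩ := (hσ.mono hrU).isExactOn_ball
  have hzr : z ∈ Metric.ball z r := Metric.mem_ball_self hr
  have hζd : DifferentiableOn ℂ ζ (Metric.ball z r) := fun y hy =>
    (hζ y hy).differentiableAt.differentiableWithinAt
  have hs : HasStrictDerivAt ζ (σ z) z := by
    have := (hζd.analyticAt (Metric.isOpen_ball.mem_nhds hzr)).hasStrictDerivAt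
    rwa [(hζ z hzr).deriv] at this
  let e := (hs.hasStrictFDerivAt_equiv (h0 z hz)).toOpenPartialHomeomorph ζ
  have he : ⇑e = ζ := HasStrictFDerivAt.toOpenPartialHomeomorph_coe _
  have hze : z ∈ e.source := HasStrictFDerivAt.mem_toOpenPartialHomeomorph_source _
  have hsz : e.symm (ζ z) = z := by rw [← he, e.left_inv hze]
  have hzt : ζ z ∈ e.target := by rw [← he]; exact e.map_source hze
  have hV : IsOpen (e.target ∩ e.symm ⁻¹' Metric.ball z r) :=
    e.symm.isOpen_inter_preimage Metric.isOpen_ball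
  obtain ⟨ε, hε, hεV⟩ := Metric.isOpen_iff.1 hV (ζ z) ⟨hzt, by rw [mem_preimage, hsz]; exact hzr⟩
  have hd : ∀ y ∈ Metric.ball (ζ z) ε, HasDerivAt e.symm (σ (e.symm y))⁻¹ y := by
    intro y hy
    obtain ⟨hy1, hy2⟩ := hεV hy
    exact e.hasDerivAt_symm hy1 (h0 _ (hrU hy2)) (by rw [he]; exact hζ _ hy2)
  have hmap : ∀ t ∈ Ioo (-ε) ε, ζ z + (t : ℂ) ∈ Metric.ball (ζ z) ε := by
    intro t ht
    rw [Metric.mem_ball, dist_eq_norm, add_sub_cancel_left, norm_real, Real.norm_eq_abs, abs_lt]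
    exact ht
  -- A primitive `ζ` of `σ` straightens the field `1 / σ`: the curve is the preimage of a horizontal
  -- segment.
  refine ⟨fun t => e.symm (ζ z + t), ε, hε, by simpa using hsz, ?_, fun t ht => ⟨?_, ?_⟩⟩
  · have h1 : ContDiffOn ℂ ∞ e.symm (Metric.ball (ζ z) ε) :=
      (DifferentiableOn.contDiffOn (fun y hy => (hd y hy).differentiableAt.differentiableWithinAt)
        Metric.isOpen_ball)
    refine (h1.restrict_scalars ℝ).comp ?_ hmap
    exact (contDiff_const.add ofRealCLM.contDiff).contDiffOn
  · exact hrU (hεV (hmap t ht)).2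
  · have h2 : HasDerivAt (fun t : ℝ => ζ z + (t : ℂ)) 1 t :=
      (ofRealCLM.hasDerivAt (x := t)).const_add (ζ z) |>.congr_deriv (by simp)
    have h3 := (hd _ (hmap t ht)).comp t h2
    rwa [mul_one] at h3

/-! ### Adapted frames -/

theorem hasDerivAt_dotProduct {V W : ℂ → Fin 3 → ℂ} {V' W' : Fin 3 → ℂ} {z : ℂ}
    (hV : HasDerivAt V V' z) (hW : HasDerivAt W W' z) :
    HasDerivAt (fun y => V y ⬝ᵥ W y) (V' ⬝ᵥ W z + V z ⬝ᵥ W') z := by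
  have hv := hasDerivAt_pi.1 hV
  have hw := hasDerivAt_pi.1 hW
  simp only [dotProduct, Fin.sum_univ_three]
  exact (((hv 0).mul (hw 0)).add ((hv 1).mul (hw 1))).add ((hv 2).mul (hw 2))
    |>.congr_deriv (by ring)

/-- A holomorphic null curve `W₀` with its first two derivatives `W₁`, `W₂` along the vector
field `1 / σ`, normalized by `W₁ · W₁ = 1`. -/
structure IsAdaptedFrame (U : Set ℂ) (σ : ℂ → ℂ) (W₀ W₁ W₂ : ℂ → Fin 3 → ℂ) : Prop where
  differentiableOn : DifferentiableOn ℂ σ U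
  ne_zero : ∀ z ∈ U, σ z ≠ 0
  deriv₀ : ∀ z ∈ U, HasDerivAt W₀ (σ z • W₁ z) z
  deriv₁ : ∀ z ∈ U, HasDerivAt W₁ (σ z • W₂ z) z
  differentiableOn₂ : DifferentiableOn ℂ W₂ U
  dot₀₀ : ∀ z ∈ U, W₀ z ⬝ᵥ W₀ z = 0
  dot₁₁ : ∀ z ∈ U, W₁ z ⬝ᵥ W₁ z = 1

/-- The Gram matrix has determinant `-1` whatever `C · C` is, so `A, B, C` is a basis of `ℂ³`. -/
theorem eq_zero_of_gram {A B C v : Fin 3 → ℂ} (h00 : A ⬝ᵥ A = 0) (h01 : A ⬝ᵥ B = 0)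
    (h11 : B ⬝ᵥ B = 1) (h02 : A ⬝ᵥ C = -1) (h12 : B ⬝ᵥ C = 0) (hA : A ⬝ᵥ v = 0)
    (hB : B ⬝ᵥ v = 0) (hC : C ⬝ᵥ v = 0) : v = 0 := by
  have hG : (Matrix.of ![A, B, C]) * (Matrix.of ![A, B, C])ᵀ =
      !![0, 0, -1; 0, 1, 0; -1, 0, C ⬝ᵥ C] := by
    ext i j
    change ![A, B, C] i ⬝ᵥ ![A, B, C] j = _
    fin_cases i <;> fin_cases j <;>
      simp [h00, h01, h11, h02, h12, dotProduct_comm B A, dotProduct_comm C A, dotProduct_comm C B]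
  have hdet := congrArg Matrix.det hG
  rw [det_mul, det_transpose] at hdet
  refine eq_zero_of_mulVec_eq_zero (M := Matrix.of ![A, B, C]) ?_ ?_
  · intro h
    rw [h, det_fin_three] at hdet
    simp at hdet
  · ext i
    change ![A, B, C] i ⬝ᵥ v = 0
    fin_cases i <;> simpa

/-- Expanding the real vector `n` gives `n · n = -α² s - 2αδ + β²` with `α, β, δ` imaginary. The
imaginary part forces `α = 0` or `s` real, and `α = 0` would leave `|n|² = β² ≤ 0`. -/
theorem im_dot_self_eq_zero_of_real_orthogonal {A B C : Fin 3 → ℂ} (h00 : A ⬝ᵥ A = 0)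
    (h01 : A ⬝ᵥ B = 0) (h11 : B ⬝ᵥ B = 1) (h02 : A ⬝ᵥ C = -1) (h12 : B ⬝ᵥ C = 0)
    {n : Fin 3 → ℝ} (hn : n ≠ 0) (hA : (A ⬝ᵥ fun j => (n j : ℂ)).re = 0)
    (hB : (B ⬝ᵥ fun j => (n j : ℂ)).re = 0) (hC : (C ⬝ᵥ fun j => (n j : ℂ)).re = 0) :
    (C ⬝ᵥ C).im = 0 := by
  set m : Fin 3 → ℂ := fun j => (n j : ℂ)
  set α := A ⬝ᵥ m
  set β := B ⬝ᵥ m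
  set δ := C ⬝ᵥ m
  set s := C ⬝ᵥ C
  have hm : m - ((-α * s - δ) • A + β • B - α • C) = 0 := by
    refine eq_zero_of_gram h00 h01 h11 h02 h12 ?_ ?_ ?_ <;>
    simp only [dotProduct_sub, dotProduct_add, dotProduct_smul, h00, h01, h11, h02, h12,
      dotProduct_comm B A, dotProduct_comm C A, dotProduct_comm C B, smul_eq_mul]
    · change α - _ = 0; ring
    · change β - _ = 0; ring
    · change δ - (_ - α * s) = 0; ring
  have hmm : m ⬝ᵥ m = -α ^ 2 * s - 2 * α * δ + β ^ 2 := by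
    have h := congrArg (· ⬝ᵥ m) (sub_eq_zero.1 hm)
    simp only [sub_dotProduct, add_dotProduct, smul_dotProduct] at h
    rw [h]
    change (-α * s - δ) * α + β * β - α * δ = _
    ring
  have hmr : m ⬝ᵥ m = ((n ⬝ᵥ n : ℝ) : ℂ) := by
    simp [m, dotProduct]
  rw [hmr] at hmm
  have hre := congrArg re hmm
  have him := congrArg im hmm
  simp [pow_two, hA, hB, hC] at hre him
  rcases him with h | h
  · rw [h] at hre
    simp at hre
    have h1 : 0 ≤ n ⬝ᵥ n := Finset.sum_nonneg fun i _ => mul_self_nonneg (n i)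
    have h2 : n ⬝ᵥ n = 0 := by nlinarith [mul_self_nonneg β.im]
    exact absurd (dotProduct_self_eq_zero.1 h2) hn
  · exact h

section

variable {U : Set ℂ} {σ : ℂ → ℂ} {W₀ W₁ W₂ : ℂ → Fin 3 → ℂ}

/-- The derivative of a constant bilinear product vanishes. -/
theorem dot_deriv_add_eq_zero (hU : IsOpen U) {V W : ℂ → Fin 3 → ℂ} {V' W' : Fin 3 → ℂ} {z c : ℂ}
    (hz : z ∈ U) (hV : HasDerivAt V V' z) (hW : HasDerivAt W W' z)
    (hc : ∀ y ∈ U, V y ⬝ᵥ W y = c) : V' ⬝ᵥ W z + V z ⬝ᵥ W' = 0 := by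
  refine (hasDerivAt_dotProduct hV hW).unique ((hasDerivAt_const z c).congr_of_eventuallyEq ?_)
  filter_upwards [hU.mem_nhds hz] with y hy using hc y hy

namespace IsAdaptedFrame

theorem dot₀₁ (h : IsAdaptedFrame U σ W₀ W₁ W₂) (hU : IsOpen U) {z : ℂ} (hz : z ∈ U) :
    W₀ z ⬝ᵥ W₁ z = 0 := by
  have h1 := dot_deriv_add_eq_zero hU hz (h.deriv₀ z hz) (h.deriv₀ z hz) h.dot₀₀
  rw [smul_dotProduct, dotProduct_smul, dotProduct_comm (W₁ z), ← two_mul] at h1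
  simpa [h.ne_zero z hz] using h1

theorem dot₁₂ (h : IsAdaptedFrame U σ W₀ W₁ W₂) (hU : IsOpen U) {z : ℂ} (hz : z ∈ U) :
    W₁ z ⬝ᵥ W₂ z = 0 := by
  have h1 := dot_deriv_add_eq_zero hU hz (h.deriv₁ z hz) (h.deriv₁ z hz) h.dot₁₁
  rw [smul_dotProduct, dotProduct_smul, dotProduct_comm (W₂ z), ← two_mul] at h1
  simpa [h.ne_zero z hz] using h1

theorem dot₀₂ (h : IsAdaptedFrame U σ W₀ W₁ W₂) (hU : IsOpen U) {z : ℂ} (hz : z ∈ U) :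
    W₀ z ⬝ᵥ W₂ z = -1 := by
  have h1 := dot_deriv_add_eq_zero hU hz (h.deriv₀ z hz) (h.deriv₁ z hz)
    (fun y hy => h.dot₀₁ hU hy)
  rw [smul_dotProduct, dotProduct_smul, h.dot₁₁ z hz, ← smul_add] at h1
  have h2 := (smul_eq_zero.1 h1).resolve_left (h.ne_zero z hz)
  linear_combination h2

/-- Rotating `σ` by a quarter turn changes the sign of `W₂ · W₂`. -/
theorem rotate (h : IsAdaptedFrame U σ W₀ W₁ W₂) :
    IsAdaptedFrame U (fun z => I * σ z) (fun z => -I • W₀ z) (fun z => -W₁ z)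
      (fun z => I • W₂ z) where
  differentiableOn := h.differentiableOn.const_mul I
  ne_zero z hz := mul_ne_zero I_ne_zero (h.ne_zero z hz)
  deriv₀ z hz := ((h.deriv₀ z hz).const_smul (-I)).congr_deriv (by
    rw [smul_smul, smul_neg, ← neg_smul, neg_mul])
  deriv₁ z hz := (h.deriv₁ z hz).neg.congr_deriv (by
    rw [smul_smul, ← neg_smul]; congr 1; linear_combination -σ z * I_sq)
  differentiableOn₂ := h.differentiableOn₂.const_smul I
  dot₀₀ z hz := by simp [h.dot₀₀ z hz]
  dot₁₁ z hz := by simp [h.dot₁₁ z hz]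

/-- If `s = W₂ · W₂` is constant, then `W₂' = -s W₁`. -/
theorem deriv₂ (h : IsAdaptedFrame U σ W₀ W₁ W₂) (hU : IsOpen U) {s : ℂ}
    (hs : ∀ z ∈ U, W₂ z ⬝ᵥ W₂ z = s) {z : ℂ} (hz : z ∈ U) :
    HasDerivAt W₂ (σ z • (-s) • W₁ z) z := by
  have hd := (h.differentiableOn₂.differentiableAt (hU.mem_nhds hz)).hasDerivAt
  have h0 := dot_deriv_add_eq_zero hU hz (h.deriv₀ z hz) hd fun y hy => h.dot₀₂ hU hy
  have h1 := dot_deriv_add_eq_zero hU hz (h.deriv₁ z hz) hd fun y hy => h.dot₁₂ hU hy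
  have h2 := dot_deriv_add_eq_zero hU hz hd hd hs
  rw [smul_dotProduct, h.dot₁₂ hU hz] at h0
  rw [smul_dotProduct, hs z hz] at h1
  rw [dotProduct_comm, ← two_mul] at h2
  -- The products of `W₂'` with the three frame vectors determine it; they come from differentiating
  -- the Gram relations.
  refine hd.congr_deriv (sub_eq_zero.1 (eq_zero_of_gram (h.dot₀₀ z hz) (h.dot₀₁ hU hz)
    (h.dot₁₁ z hz) (h.dot₀₂ hU hz) (h.dot₁₂ hU hz) ?_ ?_ ?_))
  · simp only [dotProduct_sub, dotProduct_smul, h.dot₀₁ hU hz, smul_eq_mul] at *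
    linear_combination h0
  · simp only [dotProduct_sub, dotProduct_smul, h.dot₁₁ z hz, smul_eq_mul] at *
    linear_combination h1
  · simp only [dotProduct_sub, dotProduct_smul, dotProduct_comm (W₂ z) (W₁ z), h.dot₁₂ hU hz,
      smul_eq_mul] at *
    linear_combination h2 / 2

end IsAdaptedFrame

/-- A holomorphic function with real values on a connected open set is constant. -/
theorem exists_eq_const_of_im_eq_zero (hU : IsOpen U) (hUc : IsConnected U) {f : ℂ → ℂ}
    (hf : DifferentiableOn ℂ f U) (him : ∀ z ∈ U, (f z).im = 0) :
    ∃ s : ℝ, ∀ z ∈ U, f z = s := by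
  obtain ⟨z₀, hz₀⟩ := hUc.nonempty
  have hd : ∀ z ∈ U, deriv f z = 0 := by
    intro z hz
    have hfz := (hf.differentiableAt (hU.mem_nhds hz)).hasDerivAt
    have hR := imCLM.hasFDerivAt.comp z hfz.complexToReal_fderiv
    have h0 : HasFDerivAt (fun y => imCLM (f y)) (0 : ℂ →L[ℝ] ℝ) z := by
      refine (hasFDerivAt_const (0 : ℝ) z).congr_of_eventuallyEq ?_
      filter_upwards [hU.mem_nhds hz] with y hy using him y hy
    have hL := hR.unique h0
    have h1 := congrArg (fun L => L 1) hL
    have hI := congrArg (fun L => L I) hL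
    simp at h1 hI
    exact Complex.ext hI h1
  refine ⟨(f z₀).re, fun z hz => ?_⟩
  rw [hU.is_const_of_deriv_eq_zero hUc.isPreconnected hf hd hz hz₀]
  exact Complex.ext (by simp) (by simpa using him z₀ hz₀)

end

/-! ### Planar curvature lines and the constancy of `W₂ · W₂` -/

section

variable {X : ℂ → E3} {S U : Set ℂ} {σ : ℂ → ℂ} {W₀ W₁ W₂ : ℂ → Fin 3 → ℂ}

/-- Away from umbilics, the null form of a minimal surface has an adapted frame. -/
theorem IsMinimalSurface.exists_adaptedFrame (h : IsMinimalSurface X S) (hS : IsOpen S)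
    (hU : IsOpen U) (hUc : IsSimplyConnected U) (hUS : U ⊆ S) (hQ : ∀ z ∈ U, hopf X z ≠ 0) :
    ∃ (σ : ℂ → ℂ) (W₀ W₁ W₂ : ℂ → Fin 3 → ℂ), IsAdaptedFrame U σ W₀ W₁ W₂ ∧
      (∀ z ∈ U, σ z ^ 2 = hopf X z) ∧ ∀ z ∈ U, nullForm X z = σ z • W₀ z := by
  obtain ⟨σ, hσ, h0, hsq⟩ := exists_differentiableOn_sq_eq hU hUc
    ((h.differentiableOn_hopf hS).mono hUS) hQ
  have hP := (h.differentiableOn_nullForm hS).mono hUS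
  have hW₀ : DifferentiableOn ℂ (fun z => (σ z)⁻¹ • nullForm X z) U := (hσ.inv h0).smul hP
  have hW₁ : DifferentiableOn ℂ (fun z => (σ z)⁻¹ • deriv (fun z => (σ z)⁻¹ • nullForm X z) z) U :=
    (hσ.inv h0).smul (hW₀.deriv hU)
  refine ⟨σ, fun z => (σ z)⁻¹ • nullForm X z,
    fun z => (σ z)⁻¹ • deriv (fun z => (σ z)⁻¹ • nullForm X z) z,
    fun z => (σ z)⁻¹ • deriv (fun z => (σ z)⁻¹ • deriv (fun z => (σ z)⁻¹ • nullForm X z) z) z,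
    ⟨hσ, h0, ?_, ?_, ?_, ?_, ?_⟩, hsq, ?_⟩
  · intro z hz
    refine (hW₀.differentiableAt (hU.mem_nhds hz)).hasDerivAt.congr_deriv ?_
    rw [smul_smul, mul_inv_cancel₀ (h0 z hz), one_smul]
  · intro z hz
    refine (hW₁.differentiableAt (hU.mem_nhds hz)).hasDerivAt.congr_deriv ?_
    rw [smul_smul, mul_inv_cancel₀ (h0 z hz), one_smul]
  · exact (hσ.inv h0).smul (hW₁.deriv hU)
  · intro z hz
    simp [h.conformal.nullForm_dot_self (hUS hz)]
  · intro z hz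
    -- Modulo `P` the derivative is `P' / σ`. Since `P · P = P · P' = 0`, the multiple of `P` does
    -- not contribute, and the square is `Q² / σ² = σ²`.
    have hd : deriv (fun z => (σ z)⁻¹ • nullForm X z) z = (σ z)⁻¹ • deriv (nullForm X) z +
        deriv (fun z => (σ z)⁻¹) z • nullForm X z :=
      (((hσ.inv h0).differentiableAt (hU.mem_nhds hz)).hasDerivAt.smul
        (hP.differentiableAt (hU.mem_nhds hz)).hasDerivAt).deriv
    have hne := h0 z hz
    rw [hd]
    simp only [smul_dotProduct, dotProduct_smul, add_dotProduct, dotProduct_add,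
      h.conformal.nullForm_dot_self (hUS hz), h.nullForm_dot_deriv hS (hUS hz),
      dotProduct_comm (deriv (nullForm X) z) (nullForm X z), h.deriv_dot_deriv hS (hUS hz),
      ← hsq z hz, smul_eq_mul]
    field_simp
    ring
  · intro z hz
    rw [smul_smul, mul_inv_cancel₀ (h0 z hz), one_smul]

theorem re_deriv_eq_zero {ε : ℝ} {g g' : ℝ → ℂ}
    (hg : ∀ t ∈ Ioo (-ε) ε, HasDerivAt g (g' t) t) (h0 : ∀ t ∈ Ioo (-ε) ε, (g t).re = 0) :
    ∀ t ∈ Ioo (-ε) ε, (g' t).re = 0 := by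
  intro t ht
  have h1 : HasDerivAt (fun t => (g t).re) (g' t).re t :=
    reCLM.hasFDerivAt.comp_hasDerivAt t (hg t ht)
  refine h1.unique ((hasDerivAt_const t (0 : ℝ)).congr_of_eventuallyEq ?_)
  filter_upwards [isOpen_Ioo.mem_nhds ht] with s hs using h0 s hs

/-- Planarity of the curvature lines makes `W₂ · W₂` real. -/
theorem HasPlanarCurvatureLines.im_dot_eq_zero (hX : HasPlanarCurvatureLines X S)
    (h : IsMinimalSurface X S) (hS : IsOpen S) (hU : IsOpen U) (hUS : U ⊆ S)
    (hW : IsAdaptedFrame U σ W₀ W₁ W₂) (hsq : ∀ z ∈ U, σ z ^ 2 = hopf X z)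
    (hP : ∀ z ∈ U, nullForm X z = σ z • W₀ z) : ∀ z ∈ U, (W₂ z ⬝ᵥ W₂ z).im = 0 := by
  intro z hz
  obtain ⟨γ, ε, hε, hγ0, hγ, hγ'⟩ := exists_integralCurve hU hW.differentiableOn hW.ne_zero hz
  have hline : IsCurvatureLine X S γ (Ioo (-ε) ε) := by
    refine ⟨fun t ht => hUS (hγ' t ht).1, hγ, fun t ht => ?_, fun t ht => ?_⟩
    · rw [(hγ' t ht).2.deriv]
      exact inv_ne_zero (hW.ne_zero _ (hγ' t ht).1)
    · have hzU := (hγ' t ht).1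
      have hne := hW.ne_zero _ hzU
      have hE := (h.conformal.metricFactor_pos (hUS hzU)).ne'
      -- The velocity `w = 1 / σ` satisfies `Q w² = 1`, so it is principal with `k = |σ|² / e^{2ω}`.
      refine ⟨normSq (σ (γ t)) / metricFactor X (γ t), ?_⟩
      rw [(hγ' t ht).2.deriv]
      refine h.fderiv_unitNormal hS (hUS hzU) _ _ ?_
      have hE' : (metricFactor X (γ t) : ℂ) ≠ 0 := by exact_mod_cast hE
      have hcne : (starRingEnd ℂ) (σ (γ t)) ≠ 0 := by simpa using hne
      rw [← hsq _ hzU, map_inv₀]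
      push_cast
      rw [← mul_conj]
      field_simp
  obtain ⟨n, c, hn, hc⟩ := hX γ (Ioo (-ε) ε) isOpen_Ioo ordConnected_Ioo hline
  have hd : ∀ {V V' : ℂ → Fin 3 → ℂ}, (∀ z ∈ U, HasDerivAt V (σ z • V' z) z) →
      ∀ t ∈ Ioo (-ε) ε, HasDerivAt (fun t => V (γ t) ⬝ᵥ fun j => (n j : ℂ))
        (V' (γ t) ⬝ᵥ fun j => (n j : ℂ)) t := by
    intro V V' hV t ht
    obtain ⟨hzU, hγt⟩ := hγ' t ht
    have h1 := hasDerivAt_dotProduct (hV _ hzU)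
      (hasDerivAt_const (γ t) (fun j => (n j : ℂ)))
    refine (h1.comp t hγt).congr_deriv ?_
    have hne := hW.ne_zero _ hzU
    rw [smul_dotProduct, dotProduct_zero, add_zero, smul_eq_mul]
    field_simp
  -- The derivative of `⟨n, X ∘ γ⟩` is `Re (n · P γ')`, and `P γ' = W₀` along the curve.
  have h0 : ∀ t ∈ Ioo (-ε) ε, (W₀ (γ t) ⬝ᵥ fun j => (n j : ℂ)).re = 0 := by
    intro t ht
    obtain ⟨hzU, hγt⟩ := hγ' t ht
    have hXd := ((h.conformal.contDiffAt hS (hUS hzU)).differentiableAt (by simp)).hasFDerivAt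
    have h1 := (hasDerivAt_const t n).inner ℝ (hXd.comp_hasDerivAt t hγt)
    have h2 := h1.unique ((hasDerivAt_const t c).congr_of_eventuallyEq (by
      filter_upwards [isOpen_Ioo.mem_nhds ht] with s hs using hc _ ⟨s, hs, rfl⟩))
    rw [inner_zero_left, add_zero, inner_eq_dotProduct] at h2
    rw [← h2]
    have hne := hW.ne_zero _ hzU
    simp only [dotProduct, Fin.sum_univ_three, fderiv_apply_eq_re_nullForm, hP _ hzU,
      Pi.smul_apply, smul_eq_mul]
    have hcancel : ∀ j, σ (γ t) * W₀ (γ t) j * (σ (γ t))⁻¹ = W₀ (γ t) j := fun j => by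
      field_simp
    rw [hcancel, hcancel, hcancel]
    simp
    ring
  have h1 := re_deriv_eq_zero (hd hW.deriv₀) h0
  have h2 := re_deriv_eq_zero (hd hW.deriv₁) h1
  have ht : (0 : ℝ) ∈ Ioo (-ε) ε := by simp [hε]
  have h0 := h0 0 ht
  have h1 := h1 0 ht
  have h2 := h2 0 ht
  rw [hγ0] at h0 h1 h2
  refine im_dot_self_eq_zero_of_real_orthogonal (hW.dot₀₀ z hz) (hW.dot₀₁ hU hz) (hW.dot₁₁ z hz)
    (hW.dot₀₂ hU hz) (hW.dot₁₂ hU hz) (n := n.ofLp) ?_ h0 h1 h2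
  intro hn0
  exact hn ((WithLp.ofLp_eq_zero 2).1 hn0)

/-- On a simply connected set without umbilics, planarity of the curvature lines gives an adapted
frame with `W₂ · W₂ = -κ²` for a real constant `κ ≥ 0`. -/
theorem HasPlanarCurvatureLines.exists_adaptedFrame (hX : HasPlanarCurvatureLines X S)
    (h : IsMinimalSurface X S) (hS : IsOpen S) (hU : IsOpen U) (hUc : IsSimplyConnected U)
    (hUS : U ⊆ S) (hQ : ∀ z ∈ U, hopf X z ≠ 0) :
    ∃ (σ : ℂ → ℂ) (W₀ W₁ W₂ : ℂ → Fin 3 → ℂ) (κ : ℝ), IsAdaptedFrame U σ W₀ W₁ W₂ ∧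
      (∀ z ∈ U, ‖σ z‖ ^ 2 = ‖hopf X z‖) ∧ (∀ z ∈ U, nullForm X z = σ z • W₀ z) ∧
      0 ≤ κ ∧ ∀ z ∈ U, W₂ z ⬝ᵥ W₂ z = -(κ : ℂ) ^ 2 := by
  obtain ⟨σ, W₀, W₁, W₂, hW, hsq, hP⟩ := h.exists_adaptedFrame hS hU hUc hUS hQ
  have hconn : IsConnected U := hUc.isPathConnected.isConnected
  have hdiff : DifferentiableOn ℂ (fun z => W₂ z ⬝ᵥ W₂ z) U := fun z hz =>
    have hd := (hW.differentiableOn₂.differentiableAt (hU.mem_nhds hz)).hasDerivAt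
    (hasDerivAt_dotProduct hd hd).differentiableAt.differentiableWithinAt
  obtain ⟨s, hs⟩ := exists_eq_const_of_im_eq_zero hU hconn hdiff
    (hX.im_dot_eq_zero h hS hU hUS hW hsq hP)
  have hnorm : ∀ z ∈ U, ‖σ z‖ ^ 2 = ‖hopf X z‖ := fun z hz => by rw [← norm_pow, hsq z hz]
  -- For `s ≥ 0` the rotated frame, which follows the other family of curvature lines, replaces `s`
  -- by `-s`.
  rcases le_total s 0 with h0 | h0
  · refine ⟨σ, W₀, W₁, W₂, Real.sqrt (-s), hW, hnorm, hP, Real.sqrt_nonneg _, fun z hz => ?_⟩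
    rw [hs z hz, ← ofReal_pow, Real.sq_sqrt (by linarith)]
    simp
  · refine ⟨_, _, _, _, Real.sqrt s, hW.rotate, ?_, ?_, Real.sqrt_nonneg _, fun z hz => ?_⟩
    · intro z hz
      rw [norm_mul, norm_I, one_mul, hnorm z hz]
    · intro z hz
      rw [hP z hz, smul_smul]
      congr 1
      linear_combination σ z * I_sq
    · rw [smul_dotProduct, dotProduct_smul, hs z hz, ← ofReal_pow, Real.sq_sqrt h0, smul_smul,
        I_mul_I, neg_one_smul]

end

/-! ### Integration of the frame equations -/

section

variable {U : Set ℂ} {σ : ℂ → ℂ} {W₀ W₁ W₂ : ℂ → Fin 3 → ℂ}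

namespace IsAdaptedFrame

theorem hasDerivAt_exponential (h : IsAdaptedFrame U σ W₀ W₁ W₂) (hU : IsOpen U) {κ : ℂ}
    (hκ : ∀ z ∈ U, W₂ z ⬝ᵥ W₂ z = -κ ^ 2) {z : ℂ} (hz : z ∈ U) :
    HasDerivAt (fun y => W₂ y + κ • W₁ y) ((κ * σ z) • (W₂ z + κ • W₁ z)) z := by
  refine ((h.deriv₂ hU hκ hz).add ((h.deriv₁ z hz).const_smul κ)).congr_deriv ?_
  ext j
  simp
  ring

/-- The adapted conformal parameter. -/
theorem exists_parameter (h : IsAdaptedFrame U σ W₀ W₁ W₂) (hU : IsOpen U)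
    (hUc : IsSimplyConnected U) {κ : ℝ} (hκ : ∀ z ∈ U, W₂ z ⬝ᵥ W₂ z = -(κ : ℂ) ^ 2)
    {z₀ : ℂ} (hz₀ : z₀ ∈ U) : ∃ ζ : ℂ → ℂ, ζ z₀ = 0 ∧ ∀ z ∈ U, HasDerivAt ζ (σ z) z := by
  suffices hs : ∃ ζ : ℂ → ℂ, ∀ z ∈ U, HasDerivAt ζ (σ z) z by
    obtain ⟨ζ, hζ⟩ := hs
    exact ⟨fun z => ζ z - ζ z₀, sub_self _, fun z hz => (hζ z hz).sub_const _⟩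
  have hpc : IsPreconnected U := hUc.isPathConnected.isConnected.isPreconnected
  rcases eq_or_ne κ 0 with rfl | hκ0
  · have hconst : ∀ z ∈ U, W₂ z = W₂ z₀ := by
      refine fun z hz => hU.is_const_of_deriv_eq_zero hpc h.differentiableOn₂ (fun y hy => ?_) hz hz₀
      rw [(h.deriv₂ hU (s := 0) (by simpa using hκ) hy).deriv]
      simp
    have hne : W₂ z₀ ≠ 0 := by
      intro h0
      simpa [h0] using h.dot₀₂ hU hz₀
    obtain ⟨j, hj⟩ := Function.ne_iff.1 hne
    -- Since `W₁' = σ W₂` with `W₂` constant, a component of `W₁` is already a primitive of `σ` up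
    -- to a factor.
    refine ⟨fun z => W₁ z j / W₂ z₀ j, fun z hz => ?_⟩
    refine ((hasDerivAt_pi.1 (h.deriv₁ z hz) j).div_const _).congr_deriv ?_
    rw [hconst z hz, Pi.smul_apply, smul_eq_mul, mul_div_cancel_right₀ _ hj]
  · have hκ0' : (κ : ℂ) ≠ 0 := by exact_mod_cast hκ0
    have hY := fun z hz => h.hasDerivAt_exponential hU hκ (z := z) hz
    have hZ := fun z hz => h.hasDerivAt_exponential hU (κ := -(κ : ℂ)) (by simpa using hκ)
      (z := z) hz
    have hYj := fun j z hz => hasDerivAt_pi.1 (hY z hz) j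
    have hZj := fun j z hz => hasDerivAt_pi.1 (hZ z hz) j
    -- The vectors `W₂ ± κ W₁` have logarithmic derivatives `± κ σ`, so their componentwise products
    -- are constant. Some product is nonzero because the sum is `-2κ²`; that component never
    -- vanishes, and its logarithm divided by `κ` is the parameter.
    have hconst : ∀ j, ∀ z ∈ U, (W₂ z + (κ : ℂ) • W₁ z) j * (W₂ z + (-κ : ℂ) • W₁ z) j =
        (W₂ z₀ + (κ : ℂ) • W₁ z₀) j * (W₂ z₀ + (-κ : ℂ) • W₁ z₀) j := by
      intro j z hz
      refine hU.is_const_of_deriv_eq_zero (f := fun z => (W₂ z + (κ : ℂ) • W₁ z) j *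
        (W₂ z + (-κ : ℂ) • W₁ z) j) hpc (fun y hy => ?_) (fun y hy => ?_) hz hz₀
      · exact ((hYj j y hy).mul (hZj j y hy)).differentiableAt.differentiableWithinAt
      · refine ((hYj j y hy).mul (hZj j y hy)).deriv.trans ?_
        simp
        ring
    have hdot : (W₂ z₀ + (κ : ℂ) • W₁ z₀) ⬝ᵥ (W₂ z₀ + (-κ : ℂ) • W₁ z₀) ≠ 0 := by
      simp only [add_dotProduct, dotProduct_add, smul_dotProduct, dotProduct_smul, hκ z₀ hz₀,
        h.dot₁₁ z₀ hz₀, dotProduct_comm (W₂ z₀) (W₁ z₀), h.dot₁₂ hU hz₀, smul_eq_mul]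
      ring_nf
      simpa using hκ0
    obtain ⟨j, -, hj⟩ := Finset.exists_ne_zero_of_sum_ne_zero hdot
    obtain ⟨L, hL, hexp⟩ := exists_differentiableOn_exp_eq hU hUc
      (fun z hz => (hYj j z hz).differentiableAt.differentiableWithinAt) (fun z hz h0 => by
        rw [← hconst j z hz, h0, zero_mul] at hj
        exact hj rfl)
    refine ⟨fun z => L z / κ, fun z hz => ?_⟩
    have hLz := (hL.differentiableAt (hU.mem_nhds hz)).hasDerivAt
    have he : HasDerivAt (fun y => (W₂ y + (κ : ℂ) • W₁ y) j) (exp (L z) * deriv L z) z :=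
      hLz.cexp.congr_of_eventuallyEq (by
        filter_upwards [hU.mem_nhds hz] with y hy using (hexp y hy).symm)
    have hu := he.unique (hYj j z hz)
    rw [Pi.smul_apply, ← hexp z hz, smul_eq_mul, mul_comm _ (exp (L z))] at hu
    refine (hLz.div_const _).congr_deriv ?_
    rw [mul_left_cancel₀ (exp_ne_zero _) hu, mul_div_cancel_left₀ _ hκ0']

/-- The frame equations integrated for `κ = 0`. -/
theorem eq_polynomial (h : IsAdaptedFrame U σ W₀ W₁ W₂) (hU : IsOpen U) (hUc : IsPreconnected U)
    (hκ : ∀ z ∈ U, W₂ z ⬝ᵥ W₂ z = 0) {z₀ : ℂ} (hz₀ : z₀ ∈ U) {ζ : ℂ → ℂ} (h0 : ζ z₀ = 0)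
    (hζ : ∀ z ∈ U, HasDerivAt ζ (σ z) z) :
    ∀ z ∈ U, W₀ z = W₀ z₀ + ζ z • W₁ z₀ + (ζ z ^ 2 / 2) • W₂ z₀ := by
  have hconst : ∀ {V : ℂ → Fin 3 → ℂ}, (∀ z ∈ U, HasDerivAt V 0 z) → ∀ z ∈ U, V z = V z₀ :=
    fun hV z hz => hU.is_const_of_deriv_eq_zero hUc
      (fun y hy => (hV y hy).differentiableAt.differentiableWithinAt)
      (fun y hy => (hV y hy).deriv) hz hz₀
  have h2 := hconst (V := W₂) fun z hz => (h.deriv₂ hU hκ hz).congr_deriv (by simp)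
  have h1 := hconst (V := fun z => W₁ z - ζ z • W₂ z₀) fun z hz =>
    ((h.deriv₁ z hz).sub ((hζ z hz).smul_const _)).congr_deriv (by rw [h2 z hz, sub_self])
  have h1' : ∀ z ∈ U, W₁ z = W₁ z₀ + ζ z • W₂ z₀ := fun z hz => by
    have := h1 z hz
    simp only [h0, zero_smul, sub_zero] at this
    rw [← this, sub_add_cancel]
  have h3 := hconst (V := fun z => W₀ z - (ζ z • W₁ z₀ + (ζ z ^ 2 / 2) • W₂ z₀)) fun z hz =>
    ((h.deriv₀ z hz).sub (((hζ z hz).smul_const _).add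
      ((((hζ z hz).pow 2).div_const 2).smul_const _))).congr_deriv (by
        rw [h1' z hz]
        ext j
        simp
        ring)
  intro z hz
  have := h3 z hz
  simp only [h0, zero_smul, ne_eq, OfNat.ofNat_ne_zero, not_false_eq_true, zero_pow, zero_div,
    add_zero, sub_zero] at this
  rw [← this]
  abel

/-- The frame equations integrated for `κ ≠ 0`. -/
theorem eq_exponential (h : IsAdaptedFrame U σ W₀ W₁ W₂) (hU : IsOpen U) (hUc : IsPreconnected U)
    {κ : ℂ} (hκ0 : κ ≠ 0) (hκ : ∀ z ∈ U, W₂ z ⬝ᵥ W₂ z = -κ ^ 2) {z₀ : ℂ} (hz₀ : z₀ ∈ U)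
    {ζ : ℂ → ℂ} (h0 : ζ z₀ = 0) (hζ : ∀ z ∈ U, HasDerivAt ζ (σ z) z) :
    ∀ z ∈ U, W₀ z = (W₀ z₀ - (κ ^ 2)⁻¹ • W₂ z₀) +
      (exp (κ * ζ z) / (2 * κ ^ 2)) • (W₂ z₀ + κ • W₁ z₀) +
      (exp (-κ * ζ z) / (2 * κ ^ 2)) • (W₂ z₀ - κ • W₁ z₀) := by
  have hconst : ∀ {V : ℂ → Fin 3 → ℂ}, (∀ z ∈ U, HasDerivAt V 0 z) → ∀ z ∈ U, V z = V z₀ :=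
    fun hV z hz => hU.is_const_of_deriv_eq_zero hUc
      (fun y hy => (hV y hy).differentiableAt.differentiableWithinAt)
      (fun y hy => (hV y hy).deriv) hz hz₀
  have hexp : ∀ c : ℂ, c ^ 2 = κ ^ 2 → ∀ z ∈ U,
      W₂ z + c • W₁ z = exp (c * ζ z) • (W₂ z₀ + c • W₁ z₀) := by
    intro c hc z hz
    have hc' : ∀ z ∈ U, W₂ z ⬝ᵥ W₂ z = -c ^ 2 := by simpa only [hc] using hκ
    have h1 := hconst (V := fun z => exp (-c * ζ z) • (W₂ z + c • W₁ z)) fun z hz =>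
      ((((hζ z hz).const_mul (-c)).cexp).smul (h.hasDerivAt_exponential hU hc' hz)).congr_deriv (by
        ext j
        simp
        ring)
    have h2 := h1 z hz
    simp only [h0, mul_zero, exp_zero, one_smul] at h2
    rw [← h2, smul_smul, ← exp_add]
    simp
  -- This constant vector recovers `W₀` from `W₂`, which is half the sum of the two exponential
  -- solutions.
  have h2 := hconst (V := fun z => W₂ z - κ ^ 2 • W₀ z) fun z hz =>
    ((h.deriv₂ hU hκ hz).sub ((h.deriv₀ z hz).const_smul (κ ^ 2))).congr_deriv (by
      ext j
      simp
      ring)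
  intro z hz
  have e1 := hexp κ rfl z hz
  have e2 := hexp (-κ) (by ring) z hz
  have e3 := h2 z hz
  ext j
  have f1 := congrFun e1 j
  have f2 := congrFun e2 j
  have f3 := congrFun e3 j
  simp at f1 f2 f3 ⊢
  field_simp
  linear_combination f1 + f2 - 2 * f3

end IsAdaptedFrame

end

/-! ### Boundedness of frames and absence of umbilics -/

section

variable {U : Set ℂ} {σ : ℂ → ℂ} {W₀ W₁ W₂ : ℂ → Fin 3 → ℂ}

/-- Continuity of `G` on all of `ℂ` is the point: bounded `ζ` then gives bounded `W₀`, even up to a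
boundary point where the frame is undefined. -/
theorem IsAdaptedFrame.exists_continuous_eq (h : IsAdaptedFrame U σ W₀ W₁ W₂) (hU : IsOpen U)
    (hUc : IsSimplyConnected U) {κ : ℝ} (hκ : ∀ z ∈ U, W₂ z ⬝ᵥ W₂ z = -(κ : ℂ) ^ 2) :
    ∃ (ζ : ℂ → ℂ) (G : ℂ → Fin 3 → ℂ), (∀ z ∈ U, HasDerivAt ζ (σ z) z) ∧ Continuous G ∧
      ∀ z ∈ U, W₀ z = G (ζ z) := by
  obtain ⟨z₀, hz₀⟩ := hUc.nonempty
  have hpc : IsPreconnected U := hUc.isPathConnected.isConnected.isPreconnected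
  obtain ⟨ζ, h0, hζ⟩ := h.exists_parameter hU hUc hκ hz₀
  rcases eq_or_ne κ 0 with rfl | hκ0
  · exact ⟨ζ, fun w => W₀ z₀ + w • W₁ z₀ + (w ^ 2 / 2) • W₂ z₀, hζ, by fun_prop,
      h.eq_polynomial hU hpc (by simpa using hκ) hz₀ h0 hζ⟩
  · exact ⟨ζ, fun w => (W₀ z₀ - ((κ : ℂ) ^ 2)⁻¹ • W₂ z₀) +
      (exp (κ * w) / (2 * (κ : ℂ) ^ 2)) • (W₂ z₀ + (κ : ℂ) • W₁ z₀) +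
      (exp (-κ * w) / (2 * (κ : ℂ) ^ 2)) • (W₂ z₀ - (κ : ℂ) • W₁ z₀), hζ, by fun_prop,
      h.eq_exponential hU hpc (by exact_mod_cast hκ0) hκ hz₀ h0 hζ⟩

/-- Over a bounded convex set, a frame with bounded `σ` is bounded. -/
theorem IsAdaptedFrame.exists_norm_le (h : IsAdaptedFrame U σ W₀ W₁ W₂) (hU : IsOpen U)
    (hne : U.Nonempty) (hUc : Convex ℝ U) {κ : ℝ}
    (hκ : ∀ z ∈ U, W₂ z ⬝ᵥ W₂ z = -(κ : ℂ) ^ 2) {C : ℝ} (hC : ∀ z ∈ U, ‖σ z‖ ≤ C)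
    (hb : Bornology.IsBounded U) : ∃ M, ∀ z ∈ U, ‖W₀ z‖ ≤ M := by
  have hsc : IsSimplyConnected U :=
    have := hUc.contractibleSpace hne
    (inferInstance : SimplyConnectedSpace U)
  obtain ⟨ζ, G, hζ, hG, hWG⟩ := h.exists_continuous_eq hU hsc hκ
  obtain ⟨z₀, hz₀⟩ := hne
  obtain ⟨D, hD⟩ := hb.exists_norm_le
  have hC0 : 0 ≤ C := (norm_nonneg _).trans (hC z₀ hz₀)
  have hmem : ∀ z ∈ U, ζ z ∈ Metric.closedBall (ζ z₀) (C * (D + D)) := by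
    intro z hz
    rw [mem_closedBall_iff_norm]
    refine (hUc.norm_image_sub_le_of_norm_hasDerivWithin_le
      (fun y hy => (hζ y hy).hasDerivWithinAt) hC hz₀ hz).trans ?_
    gcongr
    exact (norm_sub_le _ _).trans (add_le_add (hD z hz) (hD z₀ hz₀))
  obtain ⟨M, hM⟩ := (isCompact_closedBall (ζ z₀) (C * (D + D))).exists_bound_of_continuousOn
    hG.continuousOn
  exact ⟨M, fun z hz => by rw [hWG z hz]; exact hM _ (hmem z hz)⟩

end

variable {X : ℂ → E3} {S : Set ℂ}

/-- A non-planar minimal surface with planar curvature lines has no umbilics. -/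
theorem HasPlanarCurvatureLines.hopf_ne_zero (hX : HasPlanarCurvatureLines X S)
    (h : IsMinimalSurface X S) (hS : IsOpen S) (hSc : IsPreconnected S)
    (hn : ¬ LiesInPlane (X '' S)) : ∀ z ∈ S, hopf X z ≠ 0 := by
  intro z₀ hz₀ h0
  have hQ := h.differentiableOn_hopf hS
  have han : AnalyticOnNhd ℂ (hopf X) S := hQ.analyticOnNhd hS
  rcases (han z₀ hz₀).eventually_eq_zero_or_eventually_ne_zero with hev | hev
  · refine hn (h.liesInPlane_of_hopf_eq_zero hS hSc ?_)
    exact han.eqOn_zero_of_preconnected_of_eventuallyEq_zero hSc hz₀ hev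
  have hbd : ∀ᶠ z in 𝓝 z₀, ‖hopf X z‖ < 1 :=
    (han z₀ hz₀).continuousAt.norm.eventually_lt_const (by simp [h0])
  obtain ⟨ε, hε, hball⟩ := Metric.eventually_nhds_iff_ball.1
    ((eventually_nhdsWithin_iff.1 hev).and (hbd.and (hS.mem_nhds hz₀)))
  -- A punctured disc need not carry a root of `Q`; a half disc is convex and free of zeros, and
  -- still has `z₀` in its closure.
  set H : Set ℂ := Metric.ball z₀ ε ∩ {z | z₀.re < z.re} with hH
  have hHo : IsOpen H := Metric.isOpen_ball.inter (isOpen_lt continuous_const continuous_re)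
  have hHc : Convex ℝ H := (convex_ball z₀ ε).inter (convex_halfSpace_re_gt z₀.re)
  have hHS : H ⊆ S := fun z hz => (hball z hz.1).2.2
  have hcl : z₀ ∈ closure H := by
    rw [Metric.mem_closure_iff]
    intro δ hδ
    have hm : 0 < min δ ε / 2 := by positivity
    have hlt : min δ ε / 2 < min δ ε := by linarith
    have hd : dist (z₀ + ((min δ ε / 2 : ℝ) : ℂ)) z₀ = min δ ε / 2 := by
      rw [dist_eq_norm, add_sub_cancel_left, norm_real, Real.norm_of_nonneg hm.le]
    refine ⟨z₀ + ((min δ ε / 2 : ℝ) : ℂ), ⟨?_, ?_⟩, ?_⟩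
    · rw [Metric.mem_ball, hd]
      exact hlt.trans_le (min_le_right _ _)
    · rw [mem_ofPred_eq, add_re, ofReal_re]
      linarith
    · rw [dist_comm, hd]
      exact hlt.trans_le (min_le_left _ _)
  have hHne : H.Nonempty := closure_nonempty_iff.1 ⟨z₀, hcl⟩
  have hHQ : ∀ z ∈ H, hopf X z ≠ 0 := fun z hz => (hball z hz.1).1 (by
    intro hzz
    have hlt : z₀.re < z.re := hz.2
    rw [mem_singleton_iff.1 hzz] at hlt
    exact lt_irrefl _ hlt)
  have hHsc : IsSimplyConnected H :=
    have := hHc.contractibleSpace hHne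
    (inferInstance : SimplyConnectedSpace H)
  obtain ⟨σ, W₀, W₁, W₂, κ, hW, hσ, hP, -, hκ⟩ := hX.exists_adaptedFrame h hS hHo hHsc hHS hHQ
  have hσ1 : ∀ z ∈ H, ‖σ z‖ ≤ 1 := by
    intro z hz
    have h1 := (hball z hz.1).2.1
    rw [← hσ z hz] at h1
    exact ((sq_lt_one_iff₀ (norm_nonneg _)).1 h1).le
  obtain ⟨M, hM⟩ := hW.exists_norm_le hHo hHne hHc hκ hσ1 (Metric.isBounded_ball.subset
    inter_subset_left)
  have : (𝓝[H] z₀).NeBot := mem_closure_iff_nhdsWithin_neBot.1 hcl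
  have hle : ∀ᶠ z in 𝓝[H] z₀, ‖nullForm X z‖ ^ 2 ≤ ‖hopf X z‖ * M ^ 2 := by
    filter_upwards [self_mem_nhdsWithin] with z hz
    rw [hP z hz, norm_smul, mul_pow, hσ z hz]
    gcongr
    exact hM z hz
  have hPc := ((h.differentiableOn_nullForm hS).differentiableAt
    (hS.mem_nhds hz₀)).continuousAt.continuousWithinAt (s := H)
  have hQc := (han z₀ hz₀).continuousAt.continuousWithinAt (s := H)
  -- Here `|P|² = |Q| |W₀|²` with `W₀` bounded, so `P` would vanish at `z₀`, against immersivity.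
  have hlim : ‖nullForm X z₀‖ ^ 2 ≤ ‖hopf X z₀‖ * M ^ 2 := le_of_tendsto_of_tendsto (hPc.norm.pow 2) (hQc.norm.mul_const (M ^ 2)) hle
  rw [h0, norm_zero, zero_mul] at hlim
  have hP0 : ‖nullForm X z₀‖ = 0 := by
    have := sq_nonneg ‖nullForm X z₀‖
    exact pow_eq_zero_iff two_ne_zero |>.1 (le_antisymm hlim this)
  exact h.conformal.nullForm_ne_zero hz₀ (norm_eq_zero.1 hP0)

/-! ### The holomorphic curves behind the explicit family -/

theorem sqrtCos_sq (θ : ℝ) : sqrtCos θ ^ 2 = (Real.cos (2 * θ) : ℂ) := by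
  rw [sqrtCos, ← cpow_mul_nat]
  norm_num

theorem conj_sqrtCos (θ : ℝ) :
    (starRingEnd ℂ) (sqrtCos θ) = sqrtCos θ ∨ (starRingEnd ℂ) (sqrtCos θ) = -sqrtCos θ := by
  apply sq_eq_sq_iff_eq_or_eq_neg.1
  rw [← map_pow, sqrtCos_sq, conj_ofReal]

theorem cpow_three_halves (θ : ℝ) :
    (Real.cos (2 * θ) : ℂ) ^ (3 / 2 : ℂ) = sqrtCos θ ^ 3 := by
  rw [sqrtCos, ← cpow_mul_nat]
  norm_num

theorem cos_two_mul_eq (θ : ℝ) :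
    Real.cos (2 * θ) = (Real.cos θ - Real.sin θ) * (Real.cos θ + Real.sin θ) := by
  rw [Real.cos_two_mul']; ring

theorem cos_add_sin_pos {θ : ℝ} (h : θ ∈ Ioo (-(Real.pi / 4)) (3 * Real.pi / 4)) :
    0 < Real.cos θ + Real.sin θ := by
  have h1 : Real.cos θ + Real.sin θ = Real.sqrt 2 * Real.cos (θ - Real.pi / 4) := by
    rw [Real.cos_sub, Real.cos_pi_div_four, Real.sin_pi_div_four]
    have := Real.mul_self_sqrt (show (0 : ℝ) ≤ 2 by norm_num)
    linear_combination (-(Real.cos θ + Real.sin θ) / 2) * this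
  rw [h1]
  refine mul_pos (by positivity) (Real.cos_pos_of_mem_Ioo ⟨?_, ?_⟩) <;> linarith [h.1, h.2]

theorem cos_sub_sin_ne_zero {θ : ℝ} (h : θ ∈ Ioo (-(Real.pi / 4)) (3 * Real.pi / 4))
    (hθ : θ ≠ Real.pi / 4) : Real.cos θ - Real.sin θ ≠ 0 := by
  have h1 : Real.cos θ - Real.sin θ = Real.sqrt 2 * Real.sin (Real.pi / 4 - θ) := by
    rw [Real.sin_sub, Real.cos_pi_div_four, Real.sin_pi_div_four]
    have := Real.mul_self_sqrt (show (0 : ℝ) ≤ 2 by norm_num)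
    linear_combination (-(Real.cos θ - Real.sin θ) / 2) * this
  rw [h1]
  refine mul_ne_zero (by positivity) ?_
  have hpi := Real.pi_pos
  rcases lt_or_gt_of_ne hθ with h2 | h2
  · exact (Real.sin_pos_of_pos_of_lt_pi (by linarith) (by linarith [h.1])).ne'
  · exact (Real.sin_neg_of_neg_of_neg_pi_lt (by linarith) (by linarith [h.2])).ne

theorem sqrtCos_ne_zero {θ : ℝ} (h : θ ∈ Ioo (-(Real.pi / 4)) (3 * Real.pi / 4))
    (hθ : θ ≠ Real.pi / 4) : sqrtCos θ ≠ 0 := by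
  intro h0
  have := sqrtCos_sq θ
  rw [h0, cos_two_mul_eq] at this
  have h1 := mul_ne_zero (cos_sub_sin_ne_zero h hθ) (cos_add_sin_pos h).ne'
  norm_num at this
  exact h1 (by exact_mod_cast mul_eq_zero.2 this)

/-- The holomorphic curve with real part `X^θ`. -/
def curve (θ : ℝ) (z : ℂ) : Fin 3 → ℂ :=
  if θ = Real.pi / 4 then
    ![(z - z ^ 3 / 6) / (Real.sqrt 2 : ℂ), I * (z + z ^ 3 / 6) / (Real.sqrt 2 : ℂ), z ^ 2 / 2]
  else
    ![(Real.cos θ * z - Real.sin θ * (sinh (sqrtCos θ * z) / sqrtCos θ)) / sqrtCos θ ^ 2,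
      I * (Real.cos θ * (sinh (sqrtCos θ * z) / sqrtCos θ) - Real.sin θ * z) / sqrtCos θ ^ 2,
      (cosh (sqrtCos θ * z) - 1) / sqrtCos θ ^ 2]

/-- The derivative of `curve θ`. -/
def curveDeriv (θ : ℝ) (z : ℂ) : Fin 3 → ℂ :=
  if θ = Real.pi / 4 then
    ![(1 - z ^ 2 / 2) / (Real.sqrt 2 : ℂ), I * (1 + z ^ 2 / 2) / (Real.sqrt 2 : ℂ), z]
  else
    ![(Real.cos θ - Real.sin θ * cosh (sqrtCos θ * z)) / sqrtCos θ ^ 2,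
      I * (Real.cos θ * cosh (sqrtCos θ * z) - Real.sin θ) / sqrtCos θ ^ 2,
      sinh (sqrtCos θ * z) / sqrtCos θ]

theorem curve_zero (θ : ℝ) : curve θ 0 = 0 := by
  unfold curve
  split_ifs <;> ext j <;> fin_cases j <;> simp

theorem hasDerivAt_curve {θ : ℝ} (h : θ ∈ Ioo (-(Real.pi / 4)) (3 * Real.pi / 4)) (z : ℂ) :
    HasDerivAt (curve θ) (curveDeriv θ z) z := by
  by_cases hθ : θ = Real.pi / 4
  · unfold curve curveDeriv
    simp only [if_pos hθ]
    have h1 := hasDerivAt_id' z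
    have h2 := hasDerivAt_pow 2 z
    have h3 := hasDerivAt_pow 3 z
    rw [hasDerivAt_pi]
    intro j
    fin_cases j
    · exact ((h1.sub (h3.div_const 6)).div_const _).congr_deriv (by simp; ring)
    · exact (((h1.add (h3.div_const 6)).const_mul I).div_const _).congr_deriv (by simp; ring)
    · exact (h2.div_const 2).congr_deriv (by simp)
  · have hc := sqrtCos_ne_zero h hθ
    unfold curve curveDeriv
    simp only [if_neg hθ]
    have h1 := hasDerivAt_id' z
    have h2 := (h1.const_mul (sqrtCos θ)).csinh
    have h3 := (h1.const_mul (sqrtCos θ)).ccosh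
    have h2' : HasDerivAt (fun y => sinh (sqrtCos θ * y) / sqrtCos θ) (cosh (sqrtCos θ * z)) z :=
      (h2.div_const _).congr_deriv (by field_simp)
    rw [hasDerivAt_pi]
    intro j
    fin_cases j
    · exact (((h1.const_mul _).sub (h2'.const_mul _)).div_const _).congr_deriv (by simp)
    · exact ((((h2'.const_mul _).sub (h1.const_mul _)).const_mul I).div_const _).congr_deriv
        (by simp)
    · refine ((h3.sub_const 1).div_const _).congr_deriv ?_
      change _ = sinh (sqrtCos θ * z) / sqrtCos θ
      field_simp

theorem re_eq_of_add_conj {w v : ℂ} (h : w + (starRingEnd ℂ) w = 2 * v) : v.re = w.re := by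
  have := congrArg re h
  simp at this
  linarith

/-- Conjugation sends `sqrtCos θ` to plus or minus itself, while `sinh (c z) / c`, `cosh (c z)` and
`c²` are even in `c`. Conjugating the curve therefore only conjugates `z`, whichever sign `cos 2θ`
has. -/
theorem surface_apply {θ : ℝ} (h : θ ∈ Ioo (-(Real.pi / 4)) (3 * Real.pi / 4)) (z : ℂ)
    (j : Fin 3) : surface θ z j = (curve θ z j).re := by
  obtain ⟨x, hx⟩ : ∃ x, x = z.re := ⟨_, rfl⟩
  obtain ⟨y, hy⟩ : ∃ y, y = z.im := ⟨_, rfl⟩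
  change (surfaceC θ z.re z.im j).re = _
  rw [← hx, ← hy]
  have hz : z = x + y * I := by rw [hx, hy, re_add_im]
  have hzc : (starRingEnd ℂ) z = x - y * I := by
    rw [hz]
    simp [sub_eq_add_neg]
  apply re_eq_of_add_conj
  by_cases hθ : θ = Real.pi / 4
  · simp only [surfaceC, curve, if_pos hθ]
    fin_cases j
    · simp only [Fin.zero_eta, cons_val_zero, map_div₀, map_sub, map_pow, conj_ofReal, hzc,
        map_ofNat]
      rw [hz]
      linear_combination (-(x * y ^ 2) / (Real.sqrt 2 : ℂ)) * I_sq
    · simp only [Fin.mk_one, cons_val_one, cons_val_zero, map_div₀, map_add, map_mul, map_pow,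
        conj_ofReal, hzc, map_ofNat, conj_I]
      rw [hz]
      linear_combination ((2 * y + x ^ 2 * y + y ^ 3 / 3 * (I ^ 2 - 1)) / (Real.sqrt 2 : ℂ)) * I_sq
    · simp only [Fin.reduceFinMk, cons_val, map_div₀, map_pow, hzc, map_ofNat]
      rw [hz]
      linear_combination (y ^ 2 : ℂ) * I_sq
  · simp only [surfaceC, curve, if_neg hθ, cpow_three_halves]
    simp only [← sqrtCos_sq]
    have hc := sqrtCos_ne_zero h hθ
    have hc2 : (starRingEnd ℂ) (sqrtCos θ ^ 2) = sqrtCos θ ^ 2 := by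
      rw [sqrtCos_sq, conj_ofReal]
    have hS : (starRingEnd ℂ) (sinh (sqrtCos θ * z) / sqrtCos θ) =
        sinh (sqrtCos θ * (starRingEnd ℂ) z) / sqrtCos θ := by
      rw [map_div₀, ← sinh_conj, map_mul]
      rcases conj_sqrtCos θ with h | h <;> rw [h]
      rw [neg_mul, sinh_neg, neg_div_neg_eq]
    have hC : (starRingEnd ℂ) (cosh (sqrtCos θ * z)) = cosh (sqrtCos θ * (starRingEnd ℂ) z) := by
      rw [← cosh_conj, map_mul]
      rcases conj_sqrtCos θ with h | h <;> rw [h]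
      rw [neg_mul, cosh_neg]
    have e1 : sqrtCos θ * z = x * sqrtCos θ + (y * sqrtCos θ) * I := by rw [hz]; ring
    have e2 : sqrtCos θ * (starRingEnd ℂ) z = x * sqrtCos θ - (y * sqrtCos θ) * I := by
      rw [hzc]; ring
    rw [e2, sinh_sub, cosh_mul_I, sinh_mul_I, e1, sinh_add, cosh_mul_I, sinh_mul_I] at hS
    rw [e2, cosh_sub, cosh_mul_I, sinh_mul_I, e1, cosh_add, cosh_mul_I, sinh_mul_I] at hC
    rw [e1, sinh_add, cosh_add, cosh_mul_I, sinh_mul_I]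
    generalize sinh (x * sqrtCos θ) = a at *
    generalize cosh (x * sqrtCos θ) = b at *
    generalize cos (y * sqrtCos θ) = c at *
    generalize sin (y * sqrtCos θ) = d at *
    fin_cases j
    · simp only [Fin.zero_eta, cons_val_zero]
      rw [map_div₀, hc2, map_sub, map_mul, map_mul, hS, hzc, hz, conj_ofReal, conj_ofReal]
      field_simp
      ring
    · simp only [Fin.mk_one, cons_val_one, cons_val_zero]
      rw [map_div₀, hc2, map_mul, map_sub, map_mul, map_mul, hS, hzc, hz, conj_ofReal, conj_ofReal,
        conj_I]
      field_simp
      linear_combination 2 * (Real.cos θ * b * d - y * Real.sin θ * sqrtCos θ) * I_sq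
    · simp only [Fin.reduceFinMk, cons_val]
      rw [map_div₀, hc2, map_sub, map_one, hC]
      field_simp
      ring

/-! ### The Weierstrass data -/

theorem dataEta_differentiable (θ : ℝ) : Differentiable ℂ (dataEta θ) := by
  unfold dataEta
  split_ifs
  · exact differentiable_const _
  · fun_prop

theorem meromorphic_dataH (θ : ℝ) : Meromorphic (dataH θ) := by
  unfold dataH
  split_ifs
  · intro z
    exact AnalyticAt.meromorphicAt (by fun_prop)
  · intro z
    have h1 : AnalyticAt ℂ (fun z => sinh (sqrtCos θ / 2 * z)) z := by fun_prop
    have h2 : AnalyticAt ℂ (fun z => cosh (sqrtCos θ / 2 * z)) z := by fun_prop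
    simp only [tanh_eq_sinh_div_cosh]
    exact (MeromorphicAt.const _ z).mul (h1.meromorphicAt.div h2.meromorphicAt)

/-- Where `h^θ` is holomorphic, the denominator of the hyperbolic tangent does not vanish. -/
theorem cosh_ne_zero_of_analyticAt_dataH {θ : ℝ}
    (h : θ ∈ Ioo (-(Real.pi / 4)) (3 * Real.pi / 4)) (hθ : θ ≠ Real.pi / 4) {z : ℂ}
    (hz : AnalyticAt ℂ (dataH θ) z) : cosh (sqrtCos θ / 2 * z) ≠ 0 := by
  intro h0
  have hc := sqrtCos_ne_zero h hθ
  have hm : (Real.cos θ - Real.sin θ : ℂ) ≠ 0 := by exact_mod_cast cos_sub_sin_ne_zero h hθ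
  have hsinh : sinh (sqrtCos θ / 2 * z) ≠ 0 := by
    intro h1
    have := cosh_sq_sub_sinh_sq (sqrtCos θ / 2 * z)
    simp [h0, h1] at this
  have hd : HasDerivAt (fun y => cosh (sqrtCos θ / 2 * y))
      (sinh (sqrtCos θ / 2 * z) * (sqrtCos θ / 2)) z := by
    simpa using ((hasDerivAt_id' z).const_mul (sqrtCos θ / 2)).ccosh
  have hne : ∀ᶠ y in 𝓝[≠] z, cosh (sqrtCos θ / 2 * y) ≠ 0 := by
    have := hd.eventually_ne (c := 0) (mul_ne_zero hsinh (div_ne_zero hc two_ne_zero))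
    simpa [h0] using this
  -- At a zero of `cosh` the product `h cosh` tends to a nonzero multiple of `sinh`, whereas
  -- continuity of `h` would make the limit `0`. The value assigned to `h` at the pole plays no
  -- role.
  have hev : (fun y => dataH θ y * cosh (sqrtCos θ / 2 * y)) =ᶠ[𝓝[≠] z]
      fun y => sqrtCos θ / (Real.cos θ - Real.sin θ) * sinh (sqrtCos θ / 2 * y) := by
    filter_upwards [hne] with y hy
    rw [dataH, if_neg hθ, tanh_eq_sinh_div_cosh, mul_assoc, div_mul_cancel₀ _ hy]
  have hl : Filter.Tendsto (fun y => dataH θ y * cosh (sqrtCos θ / 2 * y)) (𝓝[≠] z)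
      (𝓝 (dataH θ z * cosh (sqrtCos θ / 2 * z))) :=
    (hz.continuousAt.mul hd.continuousAt).continuousWithinAt
  have hr : Filter.Tendsto
      (fun y => sqrtCos θ / (Real.cos θ - Real.sin θ) * sinh (sqrtCos θ / 2 * y)) (𝓝[≠] z)
      (𝓝 (sqrtCos θ / (Real.cos θ - Real.sin θ) * sinh (sqrtCos θ / 2 * z))) :=
    ContinuousAt.continuousWithinAt (by fun_prop)
  have := tendsto_nhds_unique (hl.congr' hev) hr
  rw [h0, mul_zero] at this
  exact mul_ne_zero (div_ne_zero hc hm) hsinh this.symm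

theorem curveDeriv_eq_weierstrassForm {θ : ℝ}
    (h : θ ∈ Ioo (-(Real.pi / 4)) (3 * Real.pi / 4)) {z : ℂ} (hz : AnalyticAt ℂ (dataH θ) z) :
    curveDeriv θ z = weierstrassForm (dataH θ) (dataEta θ) z := by
  by_cases hθ : θ = Real.pi / 4
  · have h2 : (Real.sqrt 2 : ℂ) ^ 2 = 2 := by
      rw [← ofReal_pow, Real.sq_sqrt (by norm_num)]; simp
    have h0 : (Real.sqrt 2 : ℂ) ≠ 0 := by simp
    simp only [curveDeriv, weierstrassForm, dataH, dataEta, if_pos hθ, div_pow, h2]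
    ext j
    fin_cases j
    · simp only [Fin.zero_eta, cons_val_zero]
      ring
    · simp only [Fin.mk_one, cons_val_one, cons_val_zero]
      ring
    · simp only [Fin.reduceFinMk, cons_val]
      field_simp
      rw [h2]
  · have hch := cosh_ne_zero_of_analyticAt_dataH h hθ hz
    have hc := sqrtCos_ne_zero h hθ
    have hm : (Real.cos θ - Real.sin θ : ℂ) ≠ 0 := by exact_mod_cast cos_sub_sin_ne_zero h hθ
    have hp : (Real.cos θ + Real.sin θ : ℂ) ≠ 0 := by exact_mod_cast (cos_add_sin_pos h).ne'
    have hmp : sqrtCos θ ^ 2 = (Real.cos θ - Real.sin θ) * (Real.cos θ + Real.sin θ) := by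
      rw [sqrtCos_sq, cos_two_mul_eq]; push_cast; ring
    have hdbl : sqrtCos θ * z = 2 * (sqrtCos θ / 2 * z) := by ring
    simp only [curveDeriv, weierstrassForm, dataH, dataEta, if_neg hθ, hdbl, cosh_two_mul,
      sinh_two_mul, tanh_eq_sinh_div_cosh, mul_pow, div_pow]
    have hid := cosh_sq_sub_sinh_sq (sqrtCos θ / 2 * z)
    generalize cosh (sqrtCos θ / 2 * z) = C at *
    generalize sinh (sqrtCos θ / 2 * z) = s at *
    ext j
    fin_cases j
    · simp only [Fin.zero_eta, cons_val_zero]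
      rw [hmp]
      field_simp
      linear_combination (-Real.cos θ : ℂ) * hid
    · simp only [Fin.mk_one, cons_val_one, cons_val_zero]
      rw [hmp]
      field_simp
      linear_combination (Real.sin θ : ℂ) * hid
    · simp only [Fin.reduceFinMk, cons_val]
      field_simp
      rw [hmp]
      ring

theorem hasWeierstrassData_surface {θ : ℝ} (h : θ ∈ Ioo (-(Real.pi / 4)) (3 * Real.pi / 4)) :
    HasWeierstrassData (surface θ) (dataH θ) (dataEta θ) :=
  ⟨meromorphic_dataH θ, dataEta_differentiable θ, curve θ,
    fun z => (hasDerivAt_curve h z).differentiableAt, curve_zero θ,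
    fun z hz => curveDeriv_eq_weierstrassForm h hz ▸ hasDerivAt_curve h z, surface_apply h⟩

/-! ### Orthonormal frames acting on complex vectors -/

/-- A vector of a real orthonormal basis, seen in `ℂ³`. -/
def complexBasis (b : OrthonormalBasis (Fin 3) ℝ E3) (i : Fin 3) : Fin 3 → ℂ := fun j => (b i j : ℂ)

section

variable (b : OrthonormalBasis (Fin 3) ℝ E3)

theorem complexBasis_dot (i j : Fin 3) :
    complexBasis b i ⬝ᵥ complexBasis b j = if i = j then 1 else 0 := by
  have h := orthonormal_iff_ite.1 b.orthonormal i j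
  rw [inner_eq_dotProduct] at h
  rw [show (if i = j then 1 else 0 : ℂ) = ((if i = j then 1 else 0 : ℝ) : ℂ) by split_ifs <;> simp,
    ← h]
  simp [dotProduct, complexBasis]

theorem sum_smul_complexBasis_dot (f : Fin 3 → ℂ) (i : Fin 3) :
    (∑ k, f k • complexBasis b k) ⬝ᵥ complexBasis b i = f i := by
  simp [sum_dotProduct, complexBasis_dot]

theorem eq_sum_complexBasis (V : Fin 3 → ℂ) :
    V = ∑ k, (V ⬝ᵥ complexBasis b k) • complexBasis b k := by
  set M : Matrix (Fin 3) (Fin 3) ℂ := Matrix.of (complexBasis b)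
  have h1 : M * Mᵀ = 1 := by
    ext i j
    change complexBasis b i ⬝ᵥ complexBasis b j = _
    rw [complexBasis_dot, one_apply]
  have h2 : Mᵀ * M = 1 := mul_eq_one_comm.1 h1
  have h3 := congrArg (fun N => N *ᵥ V) h2
  simp only [← mulVec_mulVec, one_mulVec] at h3
  conv_lhs => rw [← h3]
  ext j
  simp [mulVec, dotProduct, M, complexBasis, Finset.sum_apply, mul_comm]

theorem ext_complexBasis {V W : Fin 3 → ℂ}
    (h : ∀ i, V ⬝ᵥ complexBasis b i = W ⬝ᵥ complexBasis b i) : V = W := by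
  rw [eq_sum_complexBasis b V, eq_sum_complexBasis b W]
  simp only [h]

theorem dot_eq_sum_complexBasis (V W : Fin 3 → ℂ) :
    V ⬝ᵥ W = (V ⬝ᵥ complexBasis b 0) * (W ⬝ᵥ complexBasis b 0) +
      (V ⬝ᵥ complexBasis b 1) * (W ⬝ᵥ complexBasis b 1) +
      (V ⬝ᵥ complexBasis b 2) * (W ⬝ᵥ complexBasis b 2) := by
  conv_lhs => rw [eq_sum_complexBasis b V]
  simp [Fin.sum_univ_three, dotProduct_comm W]

end

/-- Three pairwise orthogonal vectors are nonnegative multiples of an orthonormal basis. -/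
theorem exists_orthonormalBasis_smul (v : Fin 3 → E3)
    (hv : Pairwise fun i j => inner ℝ (v i) (v j) = 0) :
    ∃ b : OrthonormalBasis (Fin 3) ℝ E3, ∀ i, v i = ‖v i‖ • b i := by
  -- Only the nonzero vectors are normalized; the basis extension fills the remaining indices.
  have hon : Orthonormal ℝ ({i | v i ≠ 0}.domRestrict fun i => ‖v i‖⁻¹ • v i) := by
    constructor
    · rintro ⟨i, hi⟩
      have hi' : ‖v i‖ ≠ 0 := norm_ne_zero_iff.2 hi
      simp [norm_smul, hi']
    · rintro ⟨i, hi⟩ ⟨j, hj⟩ hij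
      have : i ≠ j := fun h => hij (by simp [h])
      simp [inner_smul_left, inner_smul_right, hv this]
  obtain ⟨b, hb⟩ := hon.exists_orthonormalBasis_extension_of_card_eq (by simp)
  refine ⟨b, fun i => ?_⟩
  by_cases hi : v i = 0
  · simp [hi]
  · rw [hb i hi, smul_smul, mul_inv_cancel₀ (norm_ne_zero_iff.2 hi), one_smul]

/-- The third vector of an orthonormal basis may be reversed. -/
theorem exists_flip (b : OrthonormalBasis (Fin 3) ℝ E3) :
    ∃ b' : OrthonormalBasis (Fin 3) ℝ E3, b' 0 = b 0 ∧ b' 1 = b 1 ∧ b' 2 = -b 2 := by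
  have hb : ∀ i j, i ≠ j → inner ℝ (b i) (b j) = 0 := fun i j h => b.orthonormal.2 h
  obtain ⟨b', hb'⟩ := exists_orthonormalBasis_smul ![b 0, b 1, -b 2] (by
    intro i j hij
    fin_cases i <;> fin_cases j <;> first | exact absurd rfl hij | simp [hb])
  have h0 := hb' 0
  have h1 := hb' 1
  have h2 := hb' 2
  simp at h0 h1 h2
  exact ⟨b', h0.symm, h1.symm, h2.symm⟩

theorem complexBasis_neg {b b' : OrthonormalBasis (Fin 3) ℝ E3} {i : Fin 3} (h : b' i = -b i) :
    complexBasis b' i = -complexBasis b i := by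
  ext j
  simp [complexBasis, h]

theorem complexBasis_congr {b b' : OrthonormalBasis (Fin 3) ℝ E3} {i : Fin 3} (h : b' i = b i) :
    complexBasis b' i = complexBasis b i := by
  ext j
  simp [complexBasis, h]

/-- A complex vector with real bilinear square has orthogonal real and imaginary parts. -/
theorem exists_basis_of_dot_self_real {A : Fin 3 → ℂ} {s : ℝ} (hA : A ⬝ᵥ A = s) (ε δ : ℝ)
    (hε : ε ^ 2 = 1) (hδ : δ ^ 2 = 1) :
    ∃ (b : OrthonormalBasis (Fin 3) ℝ E3) (x y : ℝ), 0 ≤ x ∧ 0 ≤ y ∧ x ^ 2 - y ^ 2 = s ∧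
      A = (ε * x : ℂ) • complexBasis b 0 + (δ * y * I : ℂ) • complexBasis b 1 := by
  let p : E3 := WithLp.toLp 2 fun j => (A j).re
  let q : E3 := WithLp.toLp 2 fun j => (A j).im
  have hp : inner ℝ p p - inner ℝ q q = s := by
    have := congrArg re hA
    simp [dotProduct, Fin.sum_univ_three] at this
    simp only [inner_eq_dotProduct, dotProduct, Fin.sum_univ_three, p, q]
    linarith
  have hpq : inner ℝ p q = 0 := by
    have := congrArg im hA
    simp [dotProduct, Fin.sum_univ_three] at this
    simp [inner_eq_dotProduct, dotProduct, Fin.sum_univ_three, p, q]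
    linarith
  have hqp : inner ℝ q p = 0 := by rw [real_inner_comm, hpq]
  obtain ⟨b, hb⟩ := exists_orthonormalBasis_smul ![ε • p, δ • q, 0] (by
    intro i j hij
    fin_cases i <;> fin_cases j <;>
      first | exact absurd rfl hij | simp [inner_smul_left, inner_smul_right, hpq, hqp])
  have hε' : |ε| = 1 := by rw [← abs_one, ← sq_eq_sq_iff_abs_eq_abs, hε, one_pow]
  have hδ' : |δ| = 1 := by rw [← abs_one, ← sq_eq_sq_iff_abs_eq_abs, hδ, one_pow]
  have h0 := hb 0
  have h1 := hb 1
  simp [norm_smul, hε', hδ'] at h0 h1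
  refine ⟨b, ‖p‖, ‖q‖, norm_nonneg _, norm_nonneg _, ?_, ?_⟩
  · rwa [real_inner_self_eq_norm_sq, real_inner_self_eq_norm_sq] at hp
  · ext j
    have e0 := congrArg (fun v : E3 => v j) h0
    have e1 := congrArg (fun v : E3 => v j) h1
    simp [p, q] at e0 e1
    have f0 := congrArg ofReal e0
    have f1 := congrArg ofReal e1
    have g0 := congrArg ofReal hε
    have g1 := congrArg ofReal hδ
    push_cast at f0 f1 g0 g1
    simp [complexBasis]
    conv_lhs => rw [← re_add_im (A j)]
    linear_combination (ε : ℂ) * f0 + (δ : ℂ) * I * f1 - ((A j).re : ℂ) * g0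
      - ((A j).im : ℂ) * I * g1

/-! ### Normal forms of the null curves -/

theorem sqrtCos_of_pos {θ c : ℝ} (hc : 0 < c) (h : Real.cos (2 * θ) = c ^ 2) :
    sqrtCos θ = c := by
  rw [sqrtCos, h]
  have := ofReal_cpow (sq_nonneg c) (1 / 2)
  push_cast at this
  push_cast
  rw [← this, ← Real.sqrt_eq_rpow, Real.sqrt_sq hc.le]

/-- Isotropic directions orthogonal to `(cos θ, -i sin θ, 0)`. -/
theorem exists_isotropic {a c s y₀ y₁ y₂ : ℂ} (ha : a ≠ 0) (hc : a ^ 2 - s ^ 2 = c ^ 2)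
    (h1 : a * y₀ - s * I * y₁ = 0) (h2 : y₀ * y₀ + y₁ * y₁ + y₂ * y₂ = 0) :
    ∃ μ, y₀ = -s * μ ∧ y₁ = I * a * μ ∧ (y₂ = c * μ ∨ y₂ = -(c * μ)) := by
  have e1 : y₁ = I * a * (-I * y₁ / a) := by
    field_simp
    linear_combination y₁ * I_sq
  have e0 : y₀ = -s * (-I * y₁ / a) := by
    field_simp
    linear_combination h1
  refine ⟨-I * y₁ / a, e0, e1, ?_⟩
  generalize -I * y₁ / a = μ at *
  apply sq_eq_sq_iff_eq_or_eq_neg.1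
  rw [e0, e1] at h2
  linear_combination h2 + μ ^ 2 * hc - a ^ 2 * μ ^ 2 * I_sq

/-- Normal form of the null curves with `W₂ · W₂ < 0`. -/
theorem exists_normalForm_exponential {w₀ w₁ w₂ : Fin 3 → ℂ} {κ : ℝ} (hκ : 0 < κ)
    (h00 : w₀ ⬝ᵥ w₀ = 0) (h01 : w₀ ⬝ᵥ w₁ = 0) (h11 : w₁ ⬝ᵥ w₁ = 1) (h02 : w₀ ⬝ᵥ w₂ = -1)
    (h12 : w₁ ⬝ᵥ w₂ = 0) (h22 : w₂ ⬝ᵥ w₂ = -(κ : ℂ) ^ 2) :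
    ∃ θ ∈ Ioo (-(Real.pi / 4)) (3 * Real.pi / 4), ∃ (b : OrthonormalBasis (Fin 3) ℝ E3) (t : ℝ)
      (τ : ℂ), 0 < t ∧ ∀ ζ : ℂ, (w₀ - ((κ : ℂ) ^ 2)⁻¹ • w₂) +
      (exp (κ * ζ) / (2 * (κ : ℂ) ^ 2)) • (w₂ + (κ : ℂ) • w₁) +
      (exp (-κ * ζ) / (2 * (κ : ℂ) ^ 2)) • (w₂ - (κ : ℂ) • w₁) =
      (t : ℂ)⁻¹ • ∑ i, curveDeriv θ (t * ζ + τ) i • complexBasis b i := by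
  have hκC : (κ : ℂ) ≠ 0 := by exact_mod_cast hκ.ne'
  set A := w₀ - ((κ : ℂ) ^ 2)⁻¹ • w₂ with hA
  set Y := w₂ + (κ : ℂ) • w₁ with hY
  set Z := w₂ - (κ : ℂ) • w₁ with hZ
  have gram : w₁ ⬝ᵥ w₀ = 0 ∧ w₂ ⬝ᵥ w₀ = -1 ∧ w₂ ⬝ᵥ w₁ = 0 :=
    ⟨by rw [dotProduct_comm, h01], by rw [dotProduct_comm, h02], by rw [dotProduct_comm, h12]⟩
  obtain ⟨h10, h20, h21⟩ := gram
  have hAA : A ⬝ᵥ A = (((κ ^ 2)⁻¹ : ℝ) : ℂ) := by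
    simp only [hA, sub_dotProduct, dotProduct_sub, smul_dotProduct, dotProduct_smul, smul_eq_mul,
      h00, h02, h20, h22]
    push_cast
    field_simp
    ring
  have hAY : A ⬝ᵥ Y = 0 := by
    simp only [hA, hY, sub_dotProduct, dotProduct_add, smul_dotProduct, dotProduct_smul,
      smul_eq_mul, h01, h02, h21, h22]
    field_simp
    ring
  have hAZ : A ⬝ᵥ Z = 0 := by
    simp only [hA, hZ, sub_dotProduct, dotProduct_sub, smul_dotProduct, dotProduct_smul,
      smul_eq_mul, h01, h02, h21, h22]
    field_simp
    ring
  have hYY : Y ⬝ᵥ Y = 0 := by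
    simp only [hY, add_dotProduct, dotProduct_add, smul_dotProduct, dotProduct_smul,
      smul_eq_mul, h11, h12, h21, h22]
    ring
  have hZZ : Z ⬝ᵥ Z = 0 := by
    simp only [hZ, sub_dotProduct, dotProduct_sub, smul_dotProduct, dotProduct_smul,
      smul_eq_mul, h11, h12, h21, h22]
    ring
  have hYZ : Y ⬝ᵥ Z = -2 * (κ : ℂ) ^ 2 := by
    simp only [hY, hZ, add_dotProduct, dotProduct_sub, smul_dotProduct, dotProduct_smul,
      smul_eq_mul, h11, h12, h21, h22]
    ring
  clear_value A Y Z
  -- The signs match the constant term `(cos θ, -i sin θ, 0)` of `curveDeriv`.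
  obtain ⟨b, x, y, hx, hy, hxy, hAb⟩ := exists_basis_of_dot_self_real hAA 1 (-1) (by norm_num)
    (by norm_num)
  have hκ2 : 0 < (κ ^ 2)⁻¹ := by positivity
  have hx0 : 0 < x := by nlinarith [sq_nonneg y]
  obtain ⟨ρ, hρ0, hρ⟩ : ∃ ρ : ℝ, 0 < ρ ∧ ρ ^ 2 = x ^ 2 + y ^ 2 :=
    ⟨Real.sqrt (x ^ 2 + y ^ 2), by positivity, Real.sq_sqrt (by positivity)⟩
  -- The angle is the polar angle of `(x, y)`; `x² - y² > 0` makes `cos 2θ` positive, so `sqrtCos θ`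
  -- is the real number `c` below.
  obtain ⟨θ, hθ0, hθ1, hcos, hsin⟩ : ∃ θ : ℝ, 0 ≤ θ ∧ θ ≤ Real.pi / 2 ∧ ρ * Real.cos θ = x ∧
      ρ * Real.sin θ = y := by
    have hle : y / ρ ≤ 1 := (div_le_one hρ0).2 (abs_le_of_sq_le_sq' (by nlinarith) hρ0.le).2
    have hge : 0 ≤ y / ρ := by positivity
    refine ⟨Real.arcsin (y / ρ), Real.arcsin_nonneg.2 hge, Real.arcsin_le_pi_div_two _, ?_, ?_⟩
    · rw [Real.cos_arcsin, ← Real.sqrt_sq hρ0.le, ← Real.sqrt_mul (sq_nonneg _),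
        Real.sqrt_sq hρ0.le]
      rw [show ρ ^ 2 * (1 - (y / ρ) ^ 2) = x ^ 2 by field_simp; linarith, Real.sqrt_sq hx]
    · rw [Real.sin_arcsin (by linarith) hle]
      field_simp
  have hpi := Real.pi_pos
  have hmem : θ ∈ Ioo (-(Real.pi / 4)) (3 * Real.pi / 4) := ⟨by linarith, by linarith⟩
  set c : ℝ := (κ * ρ)⁻¹ with hc
  have hc0 : 0 < c := by positivity
  have hc2 : Real.cos (2 * θ) = c ^ 2 := by
    have h1 : ρ ^ 2 * Real.cos (2 * θ) = (κ ^ 2)⁻¹ := by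
      rw [Real.cos_two_mul', ← hxy, ← hcos, ← hsin]; ring
    rw [hc]
    field_simp at h1 ⊢
    linarith
  have hsq := sqrtCos_of_pos hc0 hc2
  have hθ : θ ≠ Real.pi / 4 := by
    rintro rfl
    rw [show 2 * (Real.pi / 4) = Real.pi / 2 by ring, Real.cos_pi_div_two] at hc2
    exact (pow_pos hc0 2).ne hc2
  have hcs : Real.cos θ ^ 2 - Real.sin θ ^ 2 = c ^ 2 := by rw [← hc2, Real.cos_two_mul']
  have hcsC : (Real.cos θ : ℂ) ^ 2 - (Real.sin θ : ℂ) ^ 2 = (c : ℂ) ^ 2 := by exact_mod_cast hcs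
  have hcosne : (Real.cos θ : ℂ) ≠ 0 := by
    intro h0
    have : Real.cos θ = 0 := by exact_mod_cast h0
    rw [this, mul_zero] at hcos
    exact hx0.ne hcos
  have hρC : (ρ : ℂ) ≠ 0 := by exact_mod_cast hρ0.ne'
  have hcC : (c : ℂ) ≠ 0 := by exact_mod_cast hc0.ne'
  have hρc : (ρ : ℂ) * (κ * c) = 1 := by
    rw [hc]
    push_cast
    field_simp
  -- isotropic vectors orthogonal to `A`
  have hiso : ∀ b' : OrthonormalBasis (Fin 3) ℝ E3, b' 0 = b 0 → b' 1 = b 1 →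
      ∀ V : Fin 3 → ℂ, A ⬝ᵥ V = 0 → V ⬝ᵥ V = 0 → ∃ μ : ℂ,
      V ⬝ᵥ complexBasis b' 0 = -Real.sin θ * μ ∧ V ⬝ᵥ complexBasis b' 1 = I * Real.cos θ * μ ∧
      (V ⬝ᵥ complexBasis b' 2 = c * μ ∨ V ⬝ᵥ complexBasis b' 2 = -(c * μ)) := by
    intro b' hb0 hb1 V hAV hVV
    refine exists_isotropic hcosne hcsC ?_ ?_
    · rw [hAb, ← complexBasis_congr hb0, ← complexBasis_congr hb1, add_dotProduct, smul_dotProduct,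
        smul_dotProduct, dotProduct_comm _ V, dotProduct_comm _ V, ← hcos, ← hsin] at hAV
      apply mul_left_cancel₀ hρC
      simp only [smul_eq_mul] at hAV
      push_cast at hAV ⊢
      linear_combination hAV
    · exact (dot_eq_sum_complexBasis b' V V).symm.trans hVV
  obtain ⟨b', hb0, hb1, μ, hμ0, hμ1, hμ2⟩ : ∃ b' : OrthonormalBasis (Fin 3) ℝ E3, b' 0 = b 0 ∧
      b' 1 = b 1 ∧ ∃ μ : ℂ, Y ⬝ᵥ complexBasis b' 0 = -Real.sin θ * μ ∧
      Y ⬝ᵥ complexBasis b' 1 = I * Real.cos θ * μ ∧ Y ⬝ᵥ complexBasis b' 2 = c * μ := by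
    obtain ⟨μ, h0, h1, h2 | h2⟩ := hiso b rfl rfl Y hAY hYY
    · exact ⟨b, rfl, rfl, μ, h0, h1, h2⟩
    · obtain ⟨b', hb0, hb1, hb2⟩ := exists_flip b
      refine ⟨b', hb0, hb1, μ, ?_, ?_, ?_⟩
      · rw [complexBasis_congr hb0, h0]
      · rw [complexBasis_congr hb1, h1]
      · rw [complexBasis_neg hb2, dotProduct_neg, h2, neg_neg]
  obtain ⟨ν, hν0, hν1, hν2⟩ := hiso b' hb0 hb1 Z hAZ hZZ
  have hμν : Y ⬝ᵥ complexBasis b' 2 * Z ⬝ᵥ complexBasis b' 2 + 2 * (κ : ℂ) ^ 2 =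
      μ * ν * (c : ℂ) ^ 2 := by
    rw [dot_eq_sum_complexBasis b', hμ0, hμ1, hν0, hν1] at hYZ
    linear_combination hYZ + μ * ν * hcsC - (Real.cos θ : ℂ) ^ 2 * μ * ν * I_sq
  -- Only two isotropic lines are orthogonal to `A`; `Y · Z ≠ 0` puts `Z` on the one not containing
  -- `Y`.
  replace hν2 : Z ⬝ᵥ complexBasis b' 2 = -(c * ν) := by
    refine hν2.resolve_left fun h => ?_
    rw [hμ2, h] at hμν
    have : (κ : ℂ) ^ 2 = 0 := by linear_combination hμν / 2
    exact hκC (pow_eq_zero_iff two_ne_zero |>.1 this)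
  rw [hμ2, hν2] at hμν
  have hμν' : μ * ν * (c : ℂ) ^ 2 = (κ : ℂ) ^ 2 := by linear_combination -hμν / 2
  have hμ : μ * c / κ ≠ 0 := by
    refine div_ne_zero (mul_ne_zero ?_ hcC) hκC
    rintro rfl
    exact hκC (pow_eq_zero_iff two_ne_zero |>.1 (by rw [← hμν']; ring))
  have htC : ((κ / c : ℝ) : ℂ) = κ / c := by push_cast; rfl
  -- The scale turns `e^{κζ}` into `e^{cz}`. The shift absorbs the factor of `Y`, and with it that
  -- of `Z`, because `μ ν c² = κ²`.
  refine ⟨θ, hmem, b', κ / c, log (μ * c / κ) / c, by positivity, fun ζ => ?_⟩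
  have hz : (c : ℂ) * (((κ / c : ℝ) : ℂ) * ζ + log (μ * c / κ) / c) = κ * ζ + log (μ * c / κ) := by
    rw [htC]
    field_simp
  have hE : exp (κ * ζ + log (μ * c / κ)) = exp (κ * ζ) * (μ * c / κ) := by
    rw [exp_add, exp_log hμ]
  have hE' : exp (-(κ * ζ + log (μ * c / κ))) = exp (-κ * ζ) * (ν * c / κ) := by
    rw [neg_add, exp_add, exp_neg (log _), exp_log hμ, neg_mul]
    congr 1
    refine inv_eq_of_mul_eq_one_right ?_
    field_simp
    linear_combination hμν'
  apply ext_complexBasis b'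
  intro i
  rw [smul_dotProduct, sum_smul_complexBasis_dot, add_dotProduct, add_dotProduct, smul_dotProduct,
    smul_dotProduct, curveDeriv, if_neg hθ, hsq, hz, cosh, sinh, hE, hE', htC]
  have hAi : ∀ i, A ⬝ᵥ complexBasis b' i = ρ * Real.cos θ * (if (0 : Fin 3) = i then 1 else 0) -
      ρ * Real.sin θ * I * (if (1 : Fin 3) = i then 1 else 0) := by
    intro i
    rw [hAb, ← complexBasis_congr hb0, ← complexBasis_congr hb1, add_dotProduct, smul_dotProduct,
      smul_dotProduct, complexBasis_dot, complexBasis_dot, ← hcos, ← hsin, smul_eq_mul, smul_eq_mul]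
    push_cast
    ring
  rw [hAi]
  generalize exp (κ * ζ) = e
  generalize exp (-κ * ζ) = e'
  have hρ' : (ρ : ℂ) = 1 / (κ * c) := by
    rw [eq_div_iff (mul_ne_zero hκC hcC), hρc]
  fin_cases i
  · simp only [Fin.zero_eta, cons_val_zero, hμ0, hν0, hρ', smul_eq_mul]
    simp
    field_simp
    ring
  · simp only [Fin.mk_one, cons_val_one, cons_val_zero, hμ1, hν1, hρ', smul_eq_mul]
    simp
    field_simp
    ring
  · simp only [Fin.reduceFinMk, cons_val, hμ2, hν2, hρ', smul_eq_mul]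
    simp
    field_simp
    ring

/-- Normal form of the null curves with `W₂ · W₂ = 0`. -/
theorem exists_normalForm_polynomial {w₀ w₁ w₂ : Fin 3 → ℂ}
    (h00 : w₀ ⬝ᵥ w₀ = 0) (h01 : w₀ ⬝ᵥ w₁ = 0) (h11 : w₁ ⬝ᵥ w₁ = 1) (h02 : w₀ ⬝ᵥ w₂ = -1)
    (h12 : w₁ ⬝ᵥ w₂ = 0) (h22 : w₂ ⬝ᵥ w₂ = 0) :
    ∃ θ ∈ Ioo (-(Real.pi / 4)) (3 * Real.pi / 4), ∃ (b : OrthonormalBasis (Fin 3) ℝ E3) (t : ℝ)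
      (τ : ℂ), 0 < t ∧ ∀ ζ : ℂ, w₀ + ζ • w₁ + (ζ ^ 2 / 2) • w₂ =
      (t : ℂ)⁻¹ • ∑ i, curveDeriv θ (t * ζ + τ) i • complexBasis b i := by
  obtain ⟨b, x, y, hx, hy, hxy, hCb⟩ := exists_basis_of_dot_self_real (s := 0) (by simpa using h22)
    (-1) 1 (by norm_num) (by norm_num)
  obtain rfl : x = y := (pow_left_inj₀ hx hy two_ne_zero).1 (by linarith)
  have hx0 : x ≠ 0 := by
    rintro rfl
    simp at hCb
    simp [hCb] at h02
  have hxC : (x : ℂ) ≠ 0 := by exact_mod_cast hx0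
  have hsq : ∀ b' : OrthonormalBasis (Fin 3) ℝ E3, b' 0 = b 0 → b' 1 = b 1 →
      w₁ ⬝ᵥ complexBasis b' 0 = I * w₁ ⬝ᵥ complexBasis b' 1 ∧
      (w₁ ⬝ᵥ complexBasis b' 2) * (w₁ ⬝ᵥ complexBasis b' 2) = 1 := by
    intro b' hb0 hb1
    rw [hCb, ← complexBasis_congr hb0, ← complexBasis_congr hb1, dotProduct_add, dotProduct_smul,
      dotProduct_smul, smul_eq_mul, smul_eq_mul] at h12
    have h0 : w₁ ⬝ᵥ complexBasis b' 0 = I * w₁ ⬝ᵥ complexBasis b' 1 := by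
      apply mul_left_cancel₀ hxC
      push_cast at h12
      linear_combination -h12
    refine ⟨h0, ?_⟩
    rw [dot_eq_sum_complexBasis b', h0] at h11
    linear_combination h11 - (w₁ ⬝ᵥ complexBasis b' 1) ^ 2 * I_sq
  obtain ⟨b', hb0, hb1, hb2⟩ : ∃ b' : OrthonormalBasis (Fin 3) ℝ E3, b' 0 = b 0 ∧ b' 1 = b 1 ∧
      w₁ ⬝ᵥ complexBasis b' 2 = 1 := by
    rcases mul_self_eq_one_iff.1 (hsq b rfl rfl).2 with h | h
    · exact ⟨b, rfl, rfl, h⟩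
    · obtain ⟨b', hb0, hb1, hb2⟩ := exists_flip b
      exact ⟨b', hb0, hb1, by rw [complexBasis_neg hb2, dotProduct_neg, h, neg_neg]⟩
  have hB0 := (hsq b' hb0 hb1).1
  rw [← complexBasis_congr hb0, ← complexBasis_congr hb1] at hCb
  have hA1 : w₀ ⬝ᵥ complexBasis b' 0 - I * w₀ ⬝ᵥ complexBasis b' 1 = 1 / x := by
    rw [hCb, dotProduct_add, dotProduct_smul, dotProduct_smul, smul_eq_mul, smul_eq_mul] at h02
    field_simp
    push_cast at h02
    linear_combination -h02
  have hA2 : w₀ ⬝ᵥ complexBasis b' 2 = -I * (w₁ ⬝ᵥ complexBasis b' 1) / x := by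
    rw [dot_eq_sum_complexBasis b', hB0, hb2] at h01
    linear_combination h01 - I * (w₁ ⬝ᵥ complexBasis b' 1) * hA1
      - (w₀ ⬝ᵥ complexBasis b' 1) * (w₁ ⬝ᵥ complexBasis b' 1) * I_sq
  have hA3 : w₀ ⬝ᵥ complexBasis b' 0 + I * w₀ ⬝ᵥ complexBasis b' 1 =
      (w₁ ⬝ᵥ complexBasis b' 1) ^ 2 / x := by
    rw [dot_eq_sum_complexBasis b', hA2] at h00
    have h1 : (1 / x : ℂ) ≠ 0 := by simpa using hx0
    apply mul_left_cancel₀ h1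
    rw [← hA1]
    have h2 : (w₀ ⬝ᵥ complexBasis b' 0 - I * w₀ ⬝ᵥ complexBasis b' 1) *
        (w₀ ⬝ᵥ complexBasis b' 0 + I * w₀ ⬝ᵥ complexBasis b' 1) =
        (w₁ ⬝ᵥ complexBasis b' 1) ^ 2 / (x : ℂ) ^ 2 := by
      linear_combination h00 - ((w₀ ⬝ᵥ complexBasis b' 1) ^ 2
        + (w₁ ⬝ᵥ complexBasis b' 1) ^ 2 / (x : ℂ) ^ 2) * I_sq
    rw [h2, hA1]
    field_simp
  have hpi := Real.pi_pos
  have hr : (Real.sqrt 2 : ℂ) ≠ 0 := by simp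
  have hr2 : (Real.sqrt 2 : ℂ) ^ 2 = 2 := by
    rw [← ofReal_pow, Real.sq_sqrt (by norm_num)]; simp
  have hxpos : 0 < x := lt_of_le_of_ne hx (Ne.symm hx0)
  -- The scale comes from the `ζ²` coefficient `W₂ = x (-1, i, 0)`; the shift comes from the third
  -- component, which must equal `(t ζ + τ) / t`.
  refine ⟨Real.pi / 4, ⟨by linarith, by linarith⟩, b', Real.sqrt 2 * x,
    -I * Real.sqrt 2 * w₁ ⬝ᵥ complexBasis b' 1, by positivity, fun ζ => ?_⟩
  apply ext_complexBasis b'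
  intro i
  rw [smul_dotProduct, sum_smul_complexBasis_dot, add_dotProduct, add_dotProduct, smul_dotProduct,
    smul_dotProduct, curveDeriv, if_pos rfl, hCb, add_dotProduct, smul_dotProduct, smul_dotProduct,
    complexBasis_dot, complexBasis_dot]
  push_cast
  have hA0 : w₀ ⬝ᵥ complexBasis b' 0 = (1 + (w₁ ⬝ᵥ complexBasis b' 1) ^ 2) / (2 * x) := by
    linear_combination (hA1 + hA3) / 2
  have hA1' : w₀ ⬝ᵥ complexBasis b' 1 = I * (1 - (w₁ ⬝ᵥ complexBasis b' 1) ^ 2) / (2 * x) := by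
    linear_combination I * (hA1 - hA3) / 2 + (w₀ ⬝ᵥ complexBasis b' 1) * I_sq
  generalize hβ : w₁ ⬝ᵥ complexBasis b' 1 = β at hA0 hA1' hA2 hB0 ⊢
  generalize (Real.sqrt 2 : ℂ) = r at *
  fin_cases i
  · simp only [Fin.zero_eta, cons_val_zero, hA0, hB0, smul_eq_mul]
    simp
    field_simp
    linear_combination hr2 + r ^ 2 * β ^ 2 * I_sq
  · simp only [Fin.mk_one, cons_val_one, cons_val_zero, hA1', hβ, smul_eq_mul]
    simp
    field_simp
    linear_combination I * hr2 + r ^ 2 * (2 * x * ζ * β - I * β ^ 2) * I_sq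
  · simp only [Fin.reduceFinMk, cons_val, hA2, hb2, smul_eq_mul]
    simp
    field_simp
    ring

/-! ### The classification -/

/-- A surface whose null form is that of `X^θ`, up to a rotation and a change of the parameter, is
a piece of `X^θ`. -/
theorem isPieceOf_of_nullForm_eq {X : ℂ → E3} {S : Set ℂ} (h : IsConformalImmersion X S)
    (hS : IsOpen S) (hSc : IsConnected S) {θ : ℝ}
    (hθ : θ ∈ Ioo (-(Real.pi / 4)) (3 * Real.pi / 4)) (b : OrthonormalBasis (Fin 3) ℝ E3) {t : ℝ}
    {τ : ℂ} (ht : 0 < t) {ζ σ : ℂ → ℂ} (hσ : ∀ z ∈ S, σ z ≠ 0)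
    (hζ : ∀ z ∈ S, HasDerivAt ζ (σ z) z)
    (hP : ∀ z ∈ S, nullForm X z = σ z • (t : ℂ)⁻¹ •
      ∑ i, curveDeriv θ (t * ζ z + τ) i • complexBasis b i) :
    IsPieceOf X S (surface θ) := by
  obtain ⟨z₀, hz₀⟩ := hSc.nonempty
  have htC : (t : ℂ) ≠ 0 := by exact_mod_cast ht.ne'
  have hφ : ∀ z ∈ S, HasDerivAt (fun z => t * ζ z + τ) (t * σ z) z := fun z hz =>
    ((hζ z hz).const_mul (t : ℂ)).add_const τ
  have hr : (0 : ℝ) < (t ^ 2)⁻¹ := by positivity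
  set Y : ℂ → E3 := fun z => b.repr.symm (surface θ (t * ζ z + τ)) with hY
  have hYj : ∀ z j, Y z j = (∑ i, curve θ (t * ζ z + τ) i * complexBasis b i j).re := by
    intro z j
    simp only [hY, ← b.sum_repr_symm, re_sum]
    simp [complexBasis, surface_apply hθ]
  have hconst : ∀ z ∈ S, X z - (t ^ 2)⁻¹ • Y z = X z₀ - (t ^ 2)⁻¹ • Y z₀ := by
    intro z hz
    ext j
    have hd : ∀ y ∈ S, HasFDerivAt (fun z => X z j - (t ^ 2)⁻¹ * Y z j) (0 : ℂ →L[ℝ] ℝ) y := by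
      intro y hy
      have hX := (EuclideanSpace.proj (𝕜 := ℝ) j).hasFDerivAt.comp y
        ((h.contDiffAt hS hy).differentiableAt (by simp)).hasFDerivAt
      have hc : HasDerivAt (fun z => ∑ i, curve θ (t * ζ z + τ) i * complexBasis b i j)
          (∑ i, curveDeriv θ (t * ζ y + τ) i * (t * σ y) * complexBasis b i j) y :=
        HasDerivAt.fun_sum fun i _ =>
          ((hasDerivAt_pi.1 (hasDerivAt_curve hθ _) i).comp y (hφ y hy)).mul_const _
      have hY' := reCLM.hasFDerivAt.comp y hc.complexToReal_fderiv
      simp only [hYj]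
      refine (hX.sub (hY'.const_mul _)).congr_fderiv ?_
      ext1 w
      -- One factor `t⁻¹` is in the normal form of `P`; the other offsets the derivative `t σ` of
      -- the new parameter.
      have e : (fderiv ℝ X y w j : ℝ) = (t ^ 2)⁻¹ *
          ((∑ i, curveDeriv θ (t * ζ y + τ) i * (t * σ y) * complexBasis b i j) * w).re := by
        rw [fderiv_apply_eq_re_nullForm, hP y hy, ← re_ofReal_mul]
        congr 1
        simp only [Pi.smul_apply, Pi.add_apply, smul_eq_mul, Fin.sum_univ_three]
        push_cast
        field_simp
      simpa using sub_eq_zero.2 e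
    have := hS.is_const_of_fderiv_eq_zero hSc.isPreconnected
      (fun y hy => (hd y hy).differentiableAt.differentiableWithinAt)
      (fun y hy => (hd y hy).fderiv) hz hz₀
    simpa using this
  -- The homothety acts after the isometry, so the translation vector is multiplied by `t²` in
  -- advance.
  refine ⟨(t ^ 2)⁻¹, b.repr.symm.toIsometryEquiv.trans
    (IsometryEquiv.addRight (t ^ 2 • (X z₀ - (t ^ 2)⁻¹ • Y z₀))), fun z => t * ζ z + τ, hr,
    fun z hz => (hφ z hz).differentiableAt.differentiableWithinAt, fun z hz => ?_, fun z hz => ?_⟩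
  · rw [(hφ z hz).deriv]
    exact mul_ne_zero htC (hσ z hz)
  · change X z = (t ^ 2)⁻¹ • (Y z + t ^ 2 • (X z₀ - (t ^ 2)⁻¹ • Y z₀))
    rw [smul_add, smul_smul, inv_mul_cancel₀ (by positivity), one_smul, ← hconst z hz]
    abel

theorem IsMinimalSurface.exists_isPieceOf {X : ℂ → E3} {S : Set ℂ} (h : IsMinimalSurface X S)
    (hX : HasPlanarCurvatureLines X S) (hS : IsOpen S) (hSc : IsSimplyConnected S)
    (hn : ¬ LiesInPlane (X '' S)) :
    ∃ θ ∈ Ioo (-(Real.pi / 4)) (3 * Real.pi / 4), IsPieceOf X S (surface θ) := by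
  have hc : IsConnected S := hSc.isPathConnected.isConnected
  obtain ⟨z₀, hz₀⟩ := hSc.nonempty
  obtain ⟨σ, W₀, W₁, W₂, κ, hW, -, hP, hκ0, hκ⟩ := hX.exists_adaptedFrame h hS hS hSc subset_rfl
    (hX.hopf_ne_zero h hS hc.isPreconnected hn)
  obtain ⟨ζ, hζ0, hζ⟩ := hW.exists_parameter hS hSc hκ hz₀
  have hgoal : ∃ θ ∈ Ioo (-(Real.pi / 4)) (3 * Real.pi / 4),
      ∃ (b : OrthonormalBasis (Fin 3) ℝ E3) (t : ℝ) (τ : ℂ), 0 < t ∧ ∀ z ∈ S,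
        W₀ z = (t : ℂ)⁻¹ • ∑ i, curveDeriv θ (t * ζ z + τ) i • complexBasis b i := by
    rcases hκ0.eq_or_lt with rfl | hκ0
    · have hκ' : ∀ z ∈ S, W₂ z ⬝ᵥ W₂ z = 0 := by simpa using hκ
      obtain ⟨θ, hθ, b, t, τ, ht, hn⟩ := exists_normalForm_polynomial (hW.dot₀₀ z₀ hz₀)
        (hW.dot₀₁ hS hz₀) (hW.dot₁₁ z₀ hz₀) (hW.dot₀₂ hS hz₀) (hW.dot₁₂ hS hz₀) (hκ' z₀ hz₀)
      exact ⟨θ, hθ, b, t, τ, ht, fun z hz => by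
        rw [hW.eq_polynomial hS hc.isPreconnected hκ' hz₀ hζ0 hζ z hz, hn]⟩
    · obtain ⟨θ, hθ, b, t, τ, ht, hn⟩ := exists_normalForm_exponential hκ0 (hW.dot₀₀ z₀ hz₀)
        (hW.dot₀₁ hS hz₀) (hW.dot₁₁ z₀ hz₀) (hW.dot₀₂ hS hz₀) (hW.dot₁₂ hS hz₀) (hκ z₀ hz₀)
      exact ⟨θ, hθ, b, t, τ, ht, fun z hz => by
        rw [hW.eq_exponential hS hc.isPreconnected (by exact_mod_cast hκ0.ne') hκ hz₀ hζ0 hζ z hz,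
          hn]⟩
  obtain ⟨θ, hθ, b, t, τ, ht, hn⟩ := hgoal
  exact ⟨θ, hθ, isPieceOf_of_nullForm_eq h.conformal hS hc hθ b ht hW.ne_zero hζ
    fun z hz => by rw [hP z hz, hn z hz]⟩

end PlanarCurv

end

theorem proposition2p8 :
    (∀ (S : Set ℂ) (X : ℂ → PlanarCurv.E3), IsOpen S → IsSimplyConnected S →
      PlanarCurv.IsMinimalSurface X S → PlanarCurv.HasPlanarCurvatureLines X S →
      ¬ PlanarCurv.LiesInPlane (X '' S) →
      ∃ θ ∈ Set.Ioo (-(Real.pi / 4)) (3 * Real.pi / 4),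
        PlanarCurv.IsPieceOf X S (PlanarCurv.surface θ)) ∧
    ∀ θ ∈ Set.Ioo (-(Real.pi / 4)) (3 * Real.pi / 4),
      PlanarCurv.HasWeierstrassData (PlanarCurv.surface θ)
        (PlanarCurv.dataH θ) (PlanarCurv.dataEta θ) := by
  refine ⟨fun S X hS hSc h hX hn => h.exists_isPieceOf hX hS hSc hn,
    fun θ hθ => PlanarCurv.hasWeierstrassData_surface hθ⟩
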